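/- **Setting.** Let $n\ge 0$. A one-round protocol consists of a pure state $|\Psi\rangle_{LE}$ on finite-dimensional systems shared by Alice ($L$) and Bob ($E$), and of channels (completely positive trace-preserving maps) $\mathcal N^x_{QL\to M_0M_0'}$ for Alice and $\mathcal M^y_{E\to M_1M_1'}$ for Bob, for $x,y\in\{0,1\}^n$, where $Q$ is a qubit. Put $M=M_0M_1$ (held by Alice after the exchange), $M'=M_0'M_1'$ (held by Bob), and $$\rho_{RMM'}(x,y)=(\mathrm{id}_R\otimes\mathcal N^x\otimes\mathcal M^y)(\Psi^+_{RQ}\otimes|\Psi\rangle\langle\Psi|_{LE}),\qquad |\Psi^+\rangle=\tfrac1{\sqrt2}(|00\rangle+|11\rangle).$$ Let $F(\rho,\sigma)=\mathrm{tr}\sqrt{\sqrt\sigma\rho\sqrt\sigma}$ and $f:\{0,1\}^n\times\{0,1\}^n\to\{0,1\}$. *$f$-routing.* The protocol is $(\epsilon_0,\epsilon_1)$-correct for $f$-routing if for all $x,y$: when $f(x,y)=0$ there is a channel $\mathcal D_{M\to Q}$ with $F(\mathcal D(\rho_{RM}),\Psi^+_{RQ})\ge 1-\epsilon_0$, and when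 $f(x,y)=1$ there is a channel $\mathcal D_{M'\to Q}$ with $F(\mathcal D(\rho_{RM'}),\Psi^+_{RQ})\ge 1-\epsilon_1$. $FR_0(f)$ (resp. $FR_1(f)$) is $\log_2$ of the minimal Schmidt rank of $|\Psi\rangle$ over all $(0,\,0.05)$-correct (resp. $(0.05,\,0)$-correct) protocols ($+\infty$ if there are none). The structure functions are $$g(x,y)=\mathrm{tr}\big(\rho_{RM'}-\tfrac{I}{2}\otimes\rho_{M'}\big)^2\ \text{ for }FR_0,\qquad \tilde g(x,y)=\mathrm{tr}\big(\rho_{RM}-\tfrac{I}{2}\otimes\rho_{M}\big)^2\ \text{ for }FR_1.$$ *$f$-BB84.* Let $\Pi^{q,b}=H^q|b\rangle\langle b|H^q$, with $H$ the Hadamard matrix. The protocol is perfectly correct for $f$-BB84 if for all $x,y$ there are POVMs $\{\Lambda^0_M,\Lambda^1_M\}$, $\{\Lambda'^0_{M'},\Lambda'^1_{M'}\}$ with $\sum_b\mathrm{tr}\big((\Pi_R^{f(x,y),b}\otimes\Lambda_M^b\otimes\Lambda'^b_{M'})\rho_{RMM'}\big)\ge1$. $pFBB84(f)$ is $\log_2$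 of the minimal Schmidt rank over such protocols ($+\infty$ if there are none). With $\rho^b_M=\langle b|_R\rho_{RM}|b\rangle_R$ and $\rho^b_{M'}=\langle b|_R\rho_{RM'}|b\rangle_R$, the structure function is $g(x,y)=\mathrm{tr}(\rho^0_M\rho^1_M)+\mathrm{tr}(\rho^0_{M'}\rho^1_{M'})$. *Functions.* $EQ(x,y)=1$ iff $x=y$; $NEQ=\neg EQ$; comparing strings as binary integers, $GT(x,y)=1$ iff $x\ge y$, and $LT(x,y)=1$ iff $x\le y$; $DISJ(x,y)=1$ iff there is no $i$ with $x_i=y_i=1$; $INT=\neg DISJ$. **Theorem.** View structure functions as $2^n\times2^n$ matrices, with rows $x$ and columns $y$ ordered as binary integers. 1. ($f$-routing, zero patterns.) The structure function of every $(0,0.05)$-correct protocol ($g$) for $EQ$, $GT$, $LT$, $DISJ$ and of every $(0.05,0)$-correct protocol ($\tilde g$) for $NEQ$, $INT$ has rank $2^n$. It is diagonal with nonzero diagonal for $EQ$ and $NEQ$; for $GT$ (resp. $LT$) it vanishes where $x<y$ (resp. $x>y$) and is nonzero on the diagonal; for $DISJ$ and $INT$ it vanishes where $x+y>2^n-1$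 and is nonzero on the antidiagonal $x+y=2^n-1$. For every $(0.05,0)$-correct protocol for $GT$ (resp. $LT$), $\tilde g$ vanishes where $x\ge y$ (resp. $x\le y$), is nonzero where $y=x+1$ (resp. $x=y+1$), and has rank $2^n-1$. 2. ($f$-BB84, zero patterns.) For every perfectly correct $f$-BB84 protocol with $f=EQ,GT,LT,DISJ$, the structure function has rank $2^n$, and it is diagonal with nonzero diagonal, triangular with nonzero diagonal (zero where $x<y$ for $GT$, where $x>y$ for $LT$), or zero where $x+y>2^n-1$ with nonzero antidiagonal, respectively. 3. $FR_0(EQ)$, $FR_1(NEQ)$, $FR_0(GT)$, $FR_1(GT)$, $FR_0(LT)$, $FR_1(LT)$, $FR_0(DISJ)$, $FR_1(INT)$ are all at least $n/4$. 4. $pFBB84(EQ)$, $pFBB84(GT)$, $pFBB84(LT)$, $pFBB84(DISJ)$ are all at least $(n-1)/4$. -/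

import Mathlib

open scoped Matrix Kronecker ComplexOrder MatrixOrder

namespace NLQC

noncomputable section

/-! ### Channels, states and fidelity in finite dimension -/

/-- Operators on the Hilbert space with orthonormal basis `a`. -/
abbrev Op (a : Type) : Type := Matrix a a ℂ

section Channels

variable {a b c d : Type} [Fintype a] [Fintype b] [Fintype c] [Fintype d]
  [DecidableEq a] [DecidableEq b] [DecidableEq c] [DecidableEq d]

/-- The tensor product `Φ ⊗ Ψ` of two linear maps of operators, the linear extension of
`A ⊗ B ↦ Φ A ⊗ Ψ B`. -/
def tensorMap (Φ : Op a →ₗ[ℂ] Op b) (Ψ : Op c →ₗ[ℂ] Op d) : Op (a × c) →ₗ[ℂ] Op (b × d) where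
  toFun X := ∑ i, ∑ j, ∑ k, ∑ l,
    X (i, k) (j, l) • (Φ (Matrix.single i j 1) ⊗ₖ Ψ (Matrix.single k l 1))
  map_add' X Y := by
    simp only [Matrix.add_apply, add_smul, Finset.sum_add_distrib]
  map_smul' r X := by
    simp only [Matrix.smul_apply, smul_assoc, Finset.smul_sum, RingHom.id_apply]

/-- A quantum channel: a completely positive trace-preserving linear map. -/
structure IsChannel (Φ : Op a →ₗ[ℂ] Op b) : Prop where
  completely_positive : ∀ (k : ℕ) (X : Op (Fin k × a)), X.PosSemidef →
    (tensorMap (LinearMap.id : Op (Fin k) →ₗ[ℂ] Op (Fin k)) Φ X).PosSemidef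
  trace_preserving : ∀ X : Op a, (Φ X).trace = X.trace

/-- The partial trace over the first tensor factor. -/
def traceLeft (X : Op (a × c)) : Op c := Matrix.of fun k l => ∑ i, X (i, k) (i, l)

/-- The operator `⟨b|_R ρ |b⟩_R` on the second factor. -/
def condState (ρ : Op (a × c)) (r : a) : Op c := Matrix.of fun k l => ρ (r, k) (r, l)

/-- The fidelity `F(ρ, σ) = tr √(√σ ρ √σ)` of density matrices (this trace is real). -/
def fidelity (ρ σ : Op a) : ℝ :=
  (CFC.sqrt (CFC.sqrt σ * ρ * CFC.sqrt σ)).trace.re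

end Channels

/-- The operator `|v⟩⟨v|`. -/
def pureState {a : Type} (v : a → ℂ) : Op a := Matrix.vecMulVec v (star v)

/-- The vector `|Ψ⁺⟩ = (|00⟩ + |11⟩) / √2`. -/
def bell (p : Fin 2 × Fin 2) : ℂ := if p.1 = p.2 then ((√2 : ℝ) : ℂ)⁻¹ else 0

/-- The Hadamard matrix `H`. -/
def hadamard : Op (Fin 2) := ((√2 : ℝ) : ℂ)⁻¹ • !![1, 1; 1, -1]

/-- The projector `Π^{q,b} = H^q |b⟩⟨b| H^q`. -/
def bb84Proj (q : ℕ) (b : Fin 2) : Op (Fin 2) := hadamard ^ q * Matrix.single b b 1 * hadamard ^ q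

/-! ### One-round non-local protocols -/

/-- Strings in `{0,1}^n`. -/
abbrev Bits (n : ℕ) : Type := Fin n → Bool

/-- A one-round protocol on inputs `x, y ∈ {0,1}^n`. The parties share a pure state `ψ` on `L ⊗ E`.
Alice holds `x`, the qubit `Q` and `L`, and applies a channel `Q L → M₀ M₀'`; Bob holds `y` and
`E`, and applies a channel `E → M₁ M₁'`. After the exchange Alice holds `M = M₀ M₁` and Bob
holds `M' = M₀' M₁'`. -/
structure Protocol (n : ℕ) where
  (dL dE dM₀ dM₀' dM₁ dM₁' : ℕ)
  ψ : Fin dL × Fin dE → ℂ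
  ψ_normalized : ∑ p, ‖ψ p‖ ^ 2 = 1
  alice : Bits n → (Op (Fin 2 × Fin dL) →ₗ[ℂ] Op (Fin dM₀ × Fin dM₀'))
  alice_isChannel : ∀ x, IsChannel (alice x)
  bob : Bits n → (Op (Fin dE) →ₗ[ℂ] Op (Fin dM₁ × Fin dM₁'))
  bob_isChannel : ∀ y, IsChannel (bob y)

namespace Protocol

variable {n : ℕ} (P : Protocol n)

/-- Basis of Alice's system `M = M₀ M₁` after the exchange. -/
abbrev M : Type := Fin P.dM₀ × Fin P.dM₁

/-- Basis of Bob's system `M' = M₀' M₁'` after the exchange. -/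
abbrev M' : Type := Fin P.dM₀' × Fin P.dM₁'

/-- The Schmidt rank of the resource state: the rank of its coefficient matrix. -/
def schmidtRank : ℕ := (Matrix.of fun i j => P.ψ (i, j)).rank

/-- The vector `|Ψ⁺⟩_{RQ} ⊗ |ψ⟩_{LE}`, on the systems `R ⊗ ((Q ⊗ L) ⊗ E)`. -/
def inputVec : Fin 2 × ((Fin 2 × Fin P.dL) × Fin P.dE) → ℂ :=
  fun i => bell (i.1, i.2.1.1) * P.ψ (i.2.1.2, i.2.2)

/-- The state `(id_R ⊗ 𝒩^x ⊗ ℳ^y)(Ψ⁺_{RQ} ⊗ ψ_{LE})`, on `R ⊗ ((M₀ ⊗ M₀') ⊗ (M₁ ⊗ M₁'))`. -/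
def rawState (x y : Bits n) :
    Op (Fin 2 × ((Fin P.dM₀ × Fin P.dM₀') × (Fin P.dM₁ × Fin P.dM₁'))) :=
  tensorMap LinearMap.id (tensorMap (P.alice x) (P.bob y)) (pureState P.inputVec)

/-- The mid-protocol density matrix `ρ_{RMM'}`. -/
def midState (x y : Bits n) : Op (Fin 2 × (P.M × P.M')) :=
  (P.rawState x y).submatrix
    (fun i => (i.1, ((i.2.1.1, i.2.2.1), (i.2.1.2, i.2.2.2))))
    (fun i => (i.1, ((i.2.1.1, i.2.2.1), (i.2.1.2, i.2.2.2))))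

/-- `ρ_{RM} = tr_{M'} ρ_{RMM'}`. -/
def stateRM (x y : Bits n) : Op (Fin 2 × P.M) :=
  Matrix.of fun i j => ∑ k : P.M', P.midState x y (i.1, (i.2, k)) (j.1, (j.2, k))

/-- `ρ_{RM'} = tr_M ρ_{RMM'}`. -/
def stateRM' (x y : Bits n) : Op (Fin 2 × P.M') :=
  Matrix.of fun i j => ∑ k : P.M, P.midState x y (i.1, (k, i.2)) (j.1, (k, j.2))

/-- The protocol completes the qubit `f`-routing task `(ε₀, ε₁)`-correctly on all inputs: Alice can
recover `Q` when `f x y = 0`, and Bob can recover `Q` when `f x y = 1`. -/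
def RoutingCorrect (f : Bits n → Bits n → Bool) (ε₀ ε₁ : ℝ) : Prop :=
  ∀ x y,
    (f x y = false → ∃ D : Op P.M →ₗ[ℂ] Op (Fin 2), IsChannel D ∧
      1 - ε₀ ≤ fidelity (tensorMap LinearMap.id D (P.stateRM x y)) (pureState bell)) ∧
    (f x y = true → ∃ D : Op P.M' →ₗ[ℂ] Op (Fin 2), IsChannel D ∧
      1 - ε₁ ≤ fidelity (tensorMap LinearMap.id D (P.stateRM' x y)) (pureState bell))

/-- The protocol completes the qubit `f`-BB84 task `ε`-correctly on all inputs: Alice and Bob have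
two-outcome measurements whose outcomes both equal, with probability at least `1 - ε`, the outcome
`b` of the measurement `{Π^{f(x,y),b}}_b` of the reference. -/
def BB84Correct (f : Bits n → Bits n → Bool) (ε : ℝ) : Prop :=
  ∀ x y, ∃ (Λ : Fin 2 → Op P.M) (Λ' : Fin 2 → Op P.M'),
    (∀ b, (Λ b).PosSemidef) ∧ ∑ b, Λ b = 1 ∧ (∀ b, (Λ' b).PosSemidef) ∧ ∑ b, Λ' b = 1 ∧
    1 - ε ≤ (∑ b, ((bb84Proj (f x y).toNat b ⊗ₖ (Λ b ⊗ₖ Λ' b)) * P.midState x y).trace).re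

/-- The structure function `g(x,y) = tr (ρ_{RM'} - I/2 ⊗ ρ_{M'})²` for `f`-routing, as a matrix. -/
def routingStructure : Matrix (Bits n) (Bits n) ℂ := Matrix.of fun x y =>
  ((P.stateRM' x y - ((1 / 2 : ℂ) • (1 : Op (Fin 2))) ⊗ₖ traceLeft (P.stateRM' x y)) ^ 2).trace

/-- The structure function with the roles of `M` and `M'` reversed,
`tr (ρ_{RM} - I/2 ⊗ ρ_M)²`, as a matrix. -/
def routingStructureRev : Matrix (Bits n) (Bits n) ℂ := Matrix.of fun x y =>
  ((P.stateRM x y - ((1 / 2 : ℂ) • (1 : Op (Fin 2))) ⊗ₖ traceLeft (P.stateRM x y)) ^ 2).trace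

/-- The structure function `g(x,y) = tr (ρ⁰_M ρ¹_M) + tr (ρ⁰_{M'} ρ¹_{M'})` for `f`-BB84,
as a matrix, where `ρᵇ_M = ⟨b|_R ρ_{RM} |b⟩_R`. -/
def bb84Structure : Matrix (Bits n) (Bits n) ℂ := Matrix.of fun x y =>
  (condState (P.stateRM x y) 0 * condState (P.stateRM x y) 1).trace +
    (condState (P.stateRM' x y) 0 * condState (P.stateRM' x y) 1).trace

end Protocol

/-! ### Entanglement cost: log of the minimal Schmidt rank (`⊤` if there is no protocol) -/

/-- The base-two logarithm of the minimal Schmidt rank of a resource state that suffices for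
`(ε₀, ε₁)`-correct `f`-routing. -/
def routingCost {n : ℕ} (f : Bits n → Bits n → Bool) (ε₀ ε₁ : ℝ) : EReal :=
  ⨅ (P : Protocol n) (_ : P.RoutingCorrect f ε₀ ε₁), ((Real.logb 2 P.schmidtRank : ℝ) : EReal)

/-- Cost of `f`-routing that is perfectly correct on zero instances, `ε₁ = 0.05`. -/
def FR₀ {n : ℕ} (f : Bits n → Bits n → Bool) : EReal := routingCost f 0 0.05

/-- Cost of `f`-routing that is perfectly correct on one instances, `ε₀ = 0.05`. -/
def FR₁ {n : ℕ} (f : Bits n → Bits n → Bool) : EReal := routingCost f 0.05 0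

/-- Cost of perfectly correct `f`-BB84. -/
def pFBB84 {n : ℕ} (f : Bits n → Bits n → Bool) : EReal :=
  ⨅ (P : Protocol n) (_ : P.BB84Correct f 0), ((Real.logb 2 P.schmidtRank : ℝ) : EReal)

/-! ### The concrete functions -/

/-- The integer in `{0, …, 2^n - 1}` with binary digits `x`. -/
def bitVal {n : ℕ} (x : Bits n) : ℕ := ∑ i : Fin n, if x i = true then 2 ^ (i : ℕ) else 0

/-- Equality. -/
def eqFn (n : ℕ) (x y : Bits n) : Bool := decide (x = y)

/-- Non-equality. -/
def neqFn (n : ℕ) (x y : Bits n) : Bool := decide (x ≠ y)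

/-- Greater-than: `1` if `x ≥ y` and `0` if `x < y`. -/
def gtFn (n : ℕ) (x y : Bits n) : Bool := decide (bitVal y ≤ bitVal x)

/-- Less-than: `1` if `x ≤ y` and `0` if `x > y`. -/
def ltFn (n : ℕ) (x y : Bits n) : Bool := decide (bitVal x ≤ bitVal y)

/-- Set-intersection: `1` if the subsets of `{1, …, n}` with indicators `x`, `y` intersect. -/
def intFn (n : ℕ) (x y : Bits n) : Bool := decide (∃ i, x i = true ∧ y i = true)

/-- Set-disjointness: `1` if the subsets of `{1, …, n}` with indicators `x`, `y` are disjoint. -/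
def disjFn (n : ℕ) (x y : Bits n) : Bool := decide (∀ i, ¬ (x i = true ∧ y i = true))

/-! ### Zero patterns; rows and columns are ordered by `bitVal` -/

section Patterns

variable {n : ℕ} (G : Matrix (Bits n) (Bits n) ℂ)

/-- `G` is diagonal with nonzero diagonal entries. -/
def DiagonalPattern : Prop :=
  (∀ x y, x ≠ y → G x y = 0) ∧ ∀ x, G x x ≠ 0

/-- `G` vanishes where `x < y` and is nonzero on the diagonal. -/
def TriangularPattern : Prop :=
  (∀ x y, bitVal x < bitVal y → G x y = 0) ∧ ∀ x, G x x ≠ 0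

/-- `G` vanishes where `x ≥ y` and is nonzero where `y = x + 1`. -/
def StrictTriangularPattern : Prop :=
  (∀ x y, bitVal y ≤ bitVal x → G x y = 0) ∧ ∀ x y, bitVal y = bitVal x + 1 → G x y ≠ 0

/-- `G` vanishes where `x + y > 2^n - 1` and is nonzero on the antidiagonal `x + y = 2^n - 1`. -/
def AntitriangularPattern : Prop :=
  (∀ x y, 2 ^ n ≤ bitVal x + bitVal y → G x y = 0) ∧
    ∀ x y, bitVal x + bitVal y + 1 = 2 ^ n → G x y ≠ 0

end Patterns

end

end NLQC

open NLQC

set_option linter.unusedSectionVars false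

namespace NLQC

/-! ### Binary strings -/

/-! The structure function, viewed as a matrix, has rank controlled from two sides.

Upper bound. A resource state of Schmidt rank `r` has a density matrix that is a sum of `r ^ 2`
products of an operator on `L` and one on `E`. Local channels and partial traces preserve this form,
so the reduced states are sums of `r ^ 2` products of a factor depending only on `x` and one
depending only on `y` (`exists_rawState_eq`). A structure function is a trace quadratic in such a
state, hence its matrix has rank at most `r ^ 4` (`rank_trace_mul_le`); the BB84 one adds two such
traces, giving `2 * r ^ 4`.

Lower bound. Correctness fixes where the entries vanish. For routing, perfect recovery on one side
decouples the reference from the other side (`marginal_swapState_eq_of_fidelity`), so the entry is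
zero; a decoupled state would give fidelity only 1/2 (`fidelity_of_decoupled`), so where the other
party must recover with fidelity 0.95 the entry is nonzero. For BB84, the entry is zero when both
parties know the computational-basis outcome, and nonzero when Bob knows the Hadamard-basis outcome,
by complementarity (`trace_condState_mul_condState_ne_zero`). For the given functions the zeros make
the matrix triangular up to reordering, so its rank is `2 ^ n`.

The strictly triangular cases have rank only `2 ^ n - 1`. The missing unit is recovered
arithmetically: `2 ^ n - 1` is a fourth power of a natural number only if it is 0 or 1. For positive
`n` this leaves `r = 1`, which is excluded because a product resource forces a row containing a zero
to vanish entirely. -/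

theorem bitVal_succ {n : ℕ} (x : Bits (n + 1)) :
    bitVal x = (x 0).toNat + 2 * bitVal (fun i : Fin n => x i.succ) := by
  simp only [bitVal, Fin.sum_univ_succ, Finset.mul_sum]
  congr 1
  · cases x 0 <;> simp
  · refine Finset.sum_congr rfl fun i _ => ?_
    split_ifs <;> simp [pow_succ, mul_comm]

theorem bitVal_injective : ∀ n : ℕ, Function.Injective (bitVal : Bits n → ℕ)
  | 0 => fun _ _ _ => Subsingleton.elim _ _
  | n + 1 => fun x y h => by
    rw [bitVal_succ, bitVal_succ] at h
    have h0 : x 0 = y 0 := by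
      cases hx : x 0 <;> cases hy : y 0 <;> simp [hx, hy] at h ⊢ <;> omega
    have h1 := bitVal_injective n (show bitVal (fun i : Fin n => x i.succ) =
      bitVal (fun i : Fin n => y i.succ) by rw [h0] at h; omega)
    funext i
    exact Fin.cases h0 (fun j => congrFun h1 j) i

theorem sum_two_pow_add_one (n : ℕ) : ∑ i : Fin n, 2 ^ (i : ℕ) + 1 = 2 ^ n := by
  rw [Fin.sum_univ_eq_sum_range (fun i => 2 ^ i), Nat.geomSum_eq le_rfl]
  have := Nat.one_le_two_pow (n := n)
  simp
  omega

theorem bitVal_add_compl {n : ℕ} (x : Bits n) : bitVal x + bitVal (fun i => !x i) + 1 = 2 ^ n := by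
  rw [← sum_two_pow_add_one, bitVal, bitVal, ← Finset.sum_add_distrib]
  congr 1
  refine Finset.sum_congr rfl fun i _ => ?_
  cases x i <;> simp

theorem bitVal_lt {n : ℕ} (x : Bits n) : bitVal x < 2 ^ n := by
  have := bitVal_add_compl x
  omega

/-- No position contributes twice, so the sum is at most that of all the powers of two.
Contrapositively, every pair beyond the antidiagonal intersects. -/
theorem bitVal_add_lt_of_disjoint {n : ℕ} {x y : Bits n}
    (h : ∀ i, ¬ (x i = true ∧ y i = true)) : bitVal x + bitVal y < 2 ^ n := by
  rw [← sum_two_pow_add_one, bitVal, bitVal, ← Finset.sum_add_distrib, Nat.lt_succ_iff]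
  refine Finset.sum_le_sum fun i _ => ?_
  have := h i
  cases hx : x i <;> cases hy : y i <;> simp_all

/-- On the antidiagonal, `y` must be the bitwise complement of `x`. -/
theorem disjoint_of_bitVal_add {n : ℕ} {x y : Bits n} (h : bitVal x + bitVal y + 1 = 2 ^ n) (i : Fin n) :
    ¬ (x i = true ∧ y i = true) := by
  have hy : y = fun i => !x i := bitVal_injective n (by have := bitVal_add_compl x; omega)
  cases hx : x i <;> simp [hy, hx]

theorem exists_bitVal_eq (n : ℕ) :
    ∃ e : Fin (2 ^ n) ≃ Bits n, ∀ i, bitVal (e i) = i := by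
  let f : Bits n → Fin (2 ^ n) := fun x => ⟨bitVal x, bitVal_lt x⟩
  have hf : Function.Bijective f := by
    rw [Fintype.bijective_iff_injective_and_card]
    exact ⟨fun x y h => bitVal_injective n (Fin.ext_iff.mp h), by simp [Bits]⟩
  refine ⟨(Equiv.ofBijective f hf).symm, fun i => ?_⟩
  exact Fin.ext_iff.mp ((Equiv.ofBijective f hf).apply_symm_apply i)

/-! ### Zero patterns and rank -/

theorem rank_of_triangular {N : ℕ} (A : Matrix (Fin N) (Fin N) ℂ)
    (h : ∀ i j, j < i → A i j = 0) (hd : ∀ i, A i i ≠ 0) : A.rank = N := by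
  have hA : A.IsUpperTriangular := fun i j hij => h i j hij
  have hdet : A.det ≠ 0 := by
    rw [Matrix.det_of_isUpperTriangular hA]
    exact Finset.prod_ne_zero_iff.mpr fun i _ => hd i
  simpa using Matrix.rank_of_det_ne_zero hdet

section

variable {n : ℕ} {G : Matrix (Bits n) (Bits n) ℂ}

theorem TriangularPattern.rank_transpose (h : TriangularPattern Gᵀ) : G.rank = 2 ^ n := by
  obtain ⟨e, he⟩ := exists_bitVal_eq n
  rw [← Matrix.rank_submatrix G e e]
  refine rank_of_triangular _ (fun i j hij => ?_) fun i => h.2 (e i)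
  exact h.1 (e j) (e i) (by rw [he, he]; exact hij)

theorem TriangularPattern.rank (h : TriangularPattern G) : G.rank = 2 ^ n := by
  rw [← Matrix.rank_transpose]
  exact TriangularPattern.rank_transpose (G := Gᵀ) h

theorem DiagonalPattern.rank (h : DiagonalPattern G) : G.rank = 2 ^ n :=
  TriangularPattern.rank
    ⟨fun x y hxy => h.1 x y (by rintro rfl; exact lt_irrefl _ hxy), h.2⟩

theorem AntitriangularPattern.rank (h : AntitriangularPattern G) : G.rank = 2 ^ n := by
  obtain ⟨e, he⟩ := exists_bitVal_eq n
  -- Reversing the order of the columns turns the antidiagonal into the diagonal.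
  rw [← Matrix.rank_submatrix G e (Fin.revPerm.trans e)]
  have hN : 0 < 2 ^ n := by positivity
  refine rank_of_triangular _ (fun i j hij => h.1 _ _ ?_) fun i => h.2 _ _ ?_
  · simp only [Equiv.trans_apply, Fin.revPerm_apply, he, Fin.val_rev]
    have := Fin.lt_def.mp hij
    omega
  · simp only [Equiv.trans_apply, Fin.revPerm_apply, he, Fin.val_rev]
    omega

theorem StrictTriangularPattern.rank (h : StrictTriangularPattern G) : G.rank = 2 ^ n - 1 := by
  obtain ⟨e, he⟩ := exists_bitVal_eq n
  have hN : 0 < 2 ^ n := by positivity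
  apply le_antisymm
  · rw [← Matrix.rank_transpose]
    classical
    -- The column indexed by 0 vanishes, because `0 ≤ x` for every row `x`.
    refine (Matrix.rank_le_card_of_support_subset Gᵀ (Finset.univ.erase (e ⟨0, hN⟩)) ?_).trans ?_
    · intro y hy
      simp only [Finset.coe_erase, Finset.coe_univ, Set.mem_sdiff, Set.mem_univ,
        Set.mem_singleton_iff, true_and]
      rintro rfl
      refine hy (funext fun x => h.1 x _ ?_)
      rw [he]
      exact Nat.zero_le _
    · simp [Bits]
  -- Deleting the last row and the first column moves the entries with `y = x + 1` onto the
  -- diagonal.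
  · let r : Fin (2 ^ n - 1) → Bits n := fun i => e ⟨i, by omega⟩
    let c : Fin (2 ^ n - 1) → Bits n := fun i => e ⟨i + 1, by omega⟩
    refine le_trans (le_of_eq ?_) (Matrix.rank_submatrix_le G r c)
    refine (rank_of_triangular _ (fun i j hij => h.1 _ _ ?_) fun i => h.2 _ _ ?_).symm
    · simp only [r, c, he]
      exact hij
    · simp only [r, c, he]

theorem StrictTriangularPattern.rank_transpose (h : StrictTriangularPattern Gᵀ) :
    G.rank = 2 ^ n - 1 := by
  rw [← Matrix.rank_transpose]
  exact h.rank

/-- An antitriangular pattern from the values where `x` and `y` intersect, resp. do not. -/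
theorem AntitriangularPattern.of_disjoint
    (h0 : ∀ x y, (∃ i, x i = true ∧ y i = true) → G x y = 0)
    (h1 : ∀ x y, (∀ i, ¬ (x i = true ∧ y i = true)) → G x y ≠ 0) : AntitriangularPattern G := by
  refine ⟨fun x y hxy => h0 x y ?_, fun x y hxy => h1 x y (disjoint_of_bitVal_add hxy)⟩
  by_contra hne
  push Not at hne
  exact absurd (bitVal_add_lt_of_disjoint (fun i hi => hne i hi.1 hi.2)) (not_lt.mpr hxy)

end

/-! ### Positive semidefinite matrices -/

section PosSemidef

variable {a b m : Type} [Fintype a] [Fintype b] [Fintype m] [DecidableEq a] [DecidableEq b]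
  [DecidableEq m]

theorem exists_eq_conjTranspose_mul_self {A : Op a} (hA : A.PosSemidef) :
    ∃ C : Op a, A = Cᴴ * C := by
  obtain ⟨C, hC⟩ := CStarAlgebra.nonneg_iff_eq_star_mul_self.mp hA.nonneg
  exact ⟨C, hC⟩

theorem trace_mul_eq_trace_conjTranspose_mul_self (C D : Op a) :
    (Cᴴ * C * (Dᴴ * D)).trace = ((C * Dᴴ)ᴴ * (C * Dᴴ)).trace := by
  rw [Matrix.conjTranspose_mul, Matrix.conjTranspose_conjTranspose, ← mul_assoc,
    Matrix.trace_mul_comm]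
  simp only [mul_assoc]

theorem trace_mul_nonneg {A B : Op a} (hA : A.PosSemidef) (hB : B.PosSemidef) :
    0 ≤ (A * B).trace := by
  obtain ⟨C, rfl⟩ := exists_eq_conjTranspose_mul_self hA
  obtain ⟨D, rfl⟩ := exists_eq_conjTranspose_mul_self hB
  rw [trace_mul_eq_trace_conjTranspose_mul_self]
  exact (Matrix.posSemidef_conjTranspose_mul_self _).trace_nonneg

/-- Writing `A = Cᴴ * C` and `B = Dᴴ * D`, the trace is the squared Hilbert-Schmidt norm of `C *
Dᴴ`. This turns events of probability zero into operator identities. -/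
theorem mul_eq_zero_of_trace_mul_eq_zero {A B : Op a} (hA : A.PosSemidef) (hB : B.PosSemidef)
    (h : (A * B).trace = 0) : A * B = 0 := by
  obtain ⟨C, rfl⟩ := exists_eq_conjTranspose_mul_self hA
  obtain ⟨D, rfl⟩ := exists_eq_conjTranspose_mul_self hB
  rw [trace_mul_eq_trace_conjTranspose_mul_self,
    Matrix.trace_conjTranspose_mul_self_eq_zero_iff] at h
  rw [mul_assoc, ← mul_assoc C, h, zero_mul, mul_zero]

theorem eq_zero_of_trace_sq_eq_zero {A : Op a} (hA : A.IsHermitian)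
    (h : (A ^ 2).trace = 0) : A = 0 := by
  rw [← Matrix.trace_conjTranspose_mul_self_eq_zero_iff, hA.eq, ← sq, h]

theorem sub_kronecker (A B : Op a) (C : Op m) : (A - B) ⊗ₖ C = A ⊗ₖ C - B ⊗ₖ C := by
  ext p q
  simp [sub_mul]

theorem kronecker_sub (A B : Op a) (C : Op m) : C ⊗ₖ (A - B) = C ⊗ₖ A - C ⊗ₖ B := by
  ext p q
  simp [mul_sub]

/-- The partial trace over the second tensor factor. -/
def traceRight (X : Op (a × m)) : Op a := Matrix.of fun i j => ∑ k, X (i, k) (j, k)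

theorem posSemidef_traceRight {X : Op (a × m)} (hX : X.PosSemidef) : (traceRight X).PosSemidef := by
  have : traceRight X = ∑ k, X.submatrix (fun i => (i, k)) (fun i => (i, k)) := by
    ext i j
    simp [traceRight, Matrix.sum_apply]
  rw [this]
  exact Matrix.posSemidef_sum _ fun k _ => hX.submatrix _

theorem posSemidef_traceLeft {X : Op (m × a)} (hX : X.PosSemidef) : (traceLeft X).PosSemidef := by
  have : traceLeft X = ∑ k, X.submatrix (fun i => (k, i)) (fun i => (k, i)) := by
    ext i j
    simp [traceLeft, Matrix.sum_apply]
  rw [this]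
  exact Matrix.posSemidef_sum _ fun k _ => hX.submatrix _

theorem trace_kronecker_one_mul (A : Op a) (X : Op (a × m)) :
    ((A ⊗ₖ (1 : Op m)) * X).trace = (A * traceRight X).trace := by
  simp only [Matrix.trace, Matrix.diag, Matrix.mul_apply, Fintype.sum_prod_type, traceRight,
    Matrix.kroneckerMap_apply, Matrix.of_apply, Matrix.one_apply, mul_ite, mul_one, mul_zero,
    ite_mul, zero_mul, Finset.sum_ite_eq, Finset.mem_univ, if_true, Finset.mul_sum]
  exact Finset.sum_congr rfl fun i _ => Finset.sum_comm

theorem trace_traceRight (X : Op (a × m)) : (traceRight X).trace = X.trace := by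
  simp [Matrix.trace, traceRight, Fintype.sum_prod_type]

theorem trace_traceLeft (X : Op (m × a)) : (traceLeft X).trace = X.trace := by
  simp only [Matrix.trace, traceLeft, Fintype.sum_prod_type, Matrix.diag, Matrix.of_apply]
  exact Finset.sum_comm

end PosSemidef

/-! ### Tensor products of maps -/

section TensorMap

variable {a b c d e : Type} [Fintype a] [Fintype b] [Fintype c] [Fintype d] [Fintype e]
  [DecidableEq a] [DecidableEq b] [DecidableEq c] [DecidableEq d] [DecidableEq e]

theorem apply_eq_sum_single (Φ : Op a →ₗ[ℂ] Op b) (A : Op a) (p q : b) :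
    Φ A p q = ∑ i, ∑ j, A i j * Φ (Matrix.single i j 1) p q := by
  conv_lhs => rw [Matrix.matrix_eq_sum_single A]
  simp only [map_sum, Matrix.sum_apply]
  refine Finset.sum_congr rfl fun i _ => Finset.sum_congr rfl fun j _ => ?_
  rw [← mul_one (A i j), ← smul_eq_mul (A i j), ← Matrix.smul_single, map_smul]
  simp

theorem tensorMap_apply (Φ : Op a →ₗ[ℂ] Op b) (Ψ : Op c →ₗ[ℂ] Op d) (X : Op (a × c))
    (p q : b × d) : tensorMap Φ Ψ X p q = ∑ i, ∑ j, ∑ k, ∑ l, X (i, k) (j, l) *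
      (Φ (Matrix.single i j 1) p.1 q.1 * Ψ (Matrix.single k l 1) p.2 q.2) := by
  simp [tensorMap, Matrix.sum_apply]

theorem tensorMap_id_left_apply (Φ : Op a →ₗ[ℂ] Op b) (X : Op (e × a)) (p q : e × b) :
    tensorMap LinearMap.id Φ X p q =
      Φ (X.submatrix (fun k => (p.1, k)) (fun k => (q.1, k))) p.2 q.2 := by
  rw [tensorMap_apply, apply_eq_sum_single]
  simp only [LinearMap.id_apply, Matrix.single_apply, Matrix.submatrix_apply]
  rw [Finset.sum_eq_single p.1, Finset.sum_eq_single q.1]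
  · simp
  · intro j _ hj
    simp [hj]
  · simp
  · intro i _ hi
    simp [hi]
  · simp

theorem tensorMap_kronecker (Φ : Op a →ₗ[ℂ] Op b) (Ψ : Op c →ₗ[ℂ] Op d) (A : Op a) (B : Op c) :
    tensorMap Φ Ψ (A ⊗ₖ B) = Φ A ⊗ₖ Ψ B := by
  ext p q
  rw [tensorMap_apply, Matrix.kroneckerMap_apply, apply_eq_sum_single Φ, apply_eq_sum_single Ψ]
  simp only [Finset.sum_mul]
  simp only [Finset.mul_sum, Matrix.kroneckerMap_apply]
  refine Finset.sum_congr rfl fun i _ => Finset.sum_congr rfl fun j _ =>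
    Finset.sum_congr rfl fun k _ => Finset.sum_congr rfl fun l _ => by ring

/-- `Φ ⊗ Ψ` is `Ψ` followed by `Φ`, each acting with an identity on the rest. The reindexings bring
the active system to the last factor, where the complete positivity in `IsChannel` applies. -/
theorem tensorMap_id_tensorMap_apply (Φ : Op a →ₗ[ℂ] Op b) (Ψ : Op c →ₗ[ℂ] Op d)
    (X : Op (e × (a × c))) (p q : e × (b × d)) :
    tensorMap LinearMap.id (tensorMap Φ Ψ) X p q =
      tensorMap LinearMap.id Φ ((tensorMap LinearMap.id Ψ
        (X.submatrix (fun i : (e × a) × c => (i.1.1, (i.1.2, i.2)))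
          (fun i : (e × a) × c => (i.1.1, (i.1.2, i.2))))).submatrix
        (fun i : (e × d) × a => ((i.1.1, i.2), i.1.2))
        (fun i : (e × d) × a => ((i.1.1, i.2), i.1.2)))
      ((p.1, p.2.2), p.2.1) ((q.1, q.2.2), q.2.1) := by
  rw [tensorMap_id_left_apply, tensorMap_apply, tensorMap_id_left_apply, apply_eq_sum_single Φ]
  refine Finset.sum_congr rfl fun i _ => Finset.sum_congr rfl fun j _ => ?_
  simp only [Matrix.submatrix_apply, tensorMap_id_left_apply]
  rw [apply_eq_sum_single Ψ, Finset.sum_mul]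
  refine Finset.sum_congr rfl fun k _ => ?_
  rw [Finset.sum_mul]
  refine Finset.sum_congr rfl fun l _ => ?_
  simp only [Matrix.submatrix_apply]
  ring

theorem IsChannel.posSemidef {Φ : Op a →ₗ[ℂ] Op b} (hΦ : IsChannel Φ) {X : Op (e × a)}
    (hX : X.PosSemidef) : (tensorMap (LinearMap.id : Op e →ₗ[ℂ] Op e) Φ X).PosSemidef := by
  let ε := Fintype.equivFin e
  have h := (hΦ.completely_positive _ (X.submatrix (fun i => (ε.symm i.1, i.2))
    (fun i => (ε.symm i.1, i.2))) (hX.submatrix _)).submatrix (fun i : e × b => (ε i.1, i.2))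
  convert h using 1
  ext p q
  simp [tensorMap_id_left_apply, Matrix.submatrix_submatrix, Function.comp_def]

theorem IsChannel.traceRight_tensorMap {Φ : Op a →ₗ[ℂ] Op b} (hΦ : IsChannel Φ) (X : Op (e × a)) :
    traceRight (tensorMap (LinearMap.id : Op e →ₗ[ℂ] Op e) Φ X) = traceRight X := by
  ext i j
  simp only [traceRight, Matrix.of_apply, tensorMap_id_left_apply]
  exact hΦ.trace_preserving (X.submatrix (fun k => (i, k)) (fun k => (j, k)))

theorem IsChannel.trace_tensorMap {Φ : Op a →ₗ[ℂ] Op b} (hΦ : IsChannel Φ) (X : Op (e × a)) :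
    (tensorMap (LinearMap.id : Op e →ₗ[ℂ] Op e) Φ X).trace = X.trace := by
  rw [← trace_traceRight, hΦ.traceRight_tensorMap, trace_traceRight]

theorem posSemidef_tensorMap_id_tensorMap {Φ : Op a →ₗ[ℂ] Op b} {Ψ : Op c →ₗ[ℂ] Op d}
    (hΦ : IsChannel Φ) (hΨ : IsChannel Ψ) {X : Op (e × (a × c))} (hX : X.PosSemidef) :
    (tensorMap (LinearMap.id : Op e →ₗ[ℂ] Op e) (tensorMap Φ Ψ) X).PosSemidef := by
  have h := (hΦ.posSemidef ((hΨ.posSemidef (hX.submatrix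
    (fun i : (e × a) × c => (i.1.1, (i.1.2, i.2))))).submatrix
      (fun i : (e × d) × a => ((i.1.1, i.2), i.1.2)))).submatrix
        (fun p : e × (b × d) => ((p.1, p.2.2), p.2.1))
  convert h using 1
  ext p q
  rw [tensorMap_id_tensorMap_apply]
  rfl

theorem trace_submatrix_equiv (ε : a ≃ b) (X : Op b) : (X.submatrix ε ε).trace = X.trace := by
  simp only [Matrix.trace, Matrix.diag, Matrix.submatrix_apply]
  exact ε.sum_comp fun i => X i i

theorem trace_tensorMap_id_tensorMap {Φ : Op a →ₗ[ℂ] Op b} {Ψ : Op c →ₗ[ℂ] Op d}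
    (hΦ : IsChannel Φ) (hΨ : IsChannel Ψ) (X : Op (e × (a × c))) :
    (tensorMap (LinearMap.id : Op e →ₗ[ℂ] Op e) (tensorMap Φ Ψ) X).trace = X.trace := by
  let ε₁ : (e × a) × c ≃ e × (a × c) := Equiv.prodAssoc e a c
  let ε₂ : (e × d) × a ≃ (e × a) × d :=
    ⟨fun i => ((i.1.1, i.2), i.1.2), fun i => ((i.1.1, i.2), i.1.2), fun _ => rfl, fun _ => rfl⟩
  let ε₃ : e × (b × d) ≃ (e × d) × b :=
    ⟨fun p => ((p.1, p.2.2), p.2.1), fun p => (p.1.1, (p.2, p.1.2)), fun _ => rfl, fun _ => rfl⟩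
  have h : tensorMap (LinearMap.id : Op e →ₗ[ℂ] Op e) (tensorMap Φ Ψ) X =
      (tensorMap LinearMap.id Φ ((tensorMap LinearMap.id Ψ (X.submatrix ε₁ ε₁)).submatrix
        ε₂ ε₂)).submatrix ε₃ ε₃ := by
    ext p q
    rw [tensorMap_id_tensorMap_apply]
    rfl
  rw [h, trace_submatrix_equiv, hΦ.trace_tensorMap, trace_submatrix_equiv, hΨ.trace_tensorMap,
    trace_submatrix_equiv]

end TensorMap

/-! ### The mid-protocol state -/

theorem inv_sqrt_two_mul_self : ((√2 : ℝ) : ℂ)⁻¹ * ((√2 : ℝ) : ℂ)⁻¹ = 1 / 2 := by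
  rw [← mul_inv, ← Complex.ofReal_mul, Real.mul_self_sqrt (by norm_num)]
  norm_num

theorem bell_mul_star_bell (p q : Fin 2 × Fin 2) :
    bell p * star (bell q) = if p.1 = p.2 ∧ q.1 = q.2 then (1 / 2 : ℂ) else 0 := by
  have h := inv_sqrt_two_mul_self
  unfold bell
  by_cases h1 : p.1 = p.2 <;> by_cases h2 : q.1 = q.2 <;> simp [h1, h2, h]

theorem trace_pureState {a : Type} [Fintype a] (v : a → ℂ) :
    (pureState v).trace = ∑ i, v i * star (v i) := by
  simp [pureState, Matrix.trace, Matrix.vecMulVec_apply]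

namespace Protocol

variable {n : ℕ} (P : Protocol n)

theorem trace_pureState_inputVec : (pureState P.inputVec).trace = 1 := by
  have hψ : ∑ p, P.ψ p * star (P.ψ p) = 1 := by
    have := P.ψ_normalized
    rw [← Complex.ofReal_inj, Complex.ofReal_sum] at this
    rw [Complex.ofReal_one] at this
    rw [← this]
    refine Finset.sum_congr rfl fun p _ => ?_
    rw [Complex.ofReal_pow, ← Complex.mul_conj']
    rfl
  have h : ∀ r q : Fin 2, ∀ l e,
      P.inputVec (r, ((q, l), e)) * star (P.inputVec (r, ((q, l), e))) =
      (bell (r, q) * star (bell (r, q))) * (P.ψ (l, e) * star (P.ψ (l, e))) := by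
    intro r q l e
    simp only [inputVec, star_mul']
    ring
  have hr (r : Fin 2) : ∑ z, P.inputVec (r, z) * star (P.inputVec (r, z)) = 1 / 2 := by
    rw [Fintype.sum_prod_type, Fintype.sum_prod_type]
    have hq (q : Fin 2) : ∑ l, ∑ e, P.inputVec (r, ((q, l), e)) * star (P.inputVec (r, ((q, l), e))) =
        if r = q then (1 / 2 : ℂ) else 0 := by
      simp_rw [h, bell_mul_star_bell, ← Finset.mul_sum, ← Fintype.sum_prod_type', hψ]
      simp
    exact (Finset.sum_congr rfl fun q _ => hq q).trans (by simp)
  rw [trace_pureState, Fintype.sum_prod_type]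
  exact (Finset.sum_congr rfl fun r _ => hr r).trans (by simp)

theorem posSemidef_midState (x y : Bits n) : (P.midState x y).PosSemidef :=
  (posSemidef_tensorMap_id_tensorMap (P.alice_isChannel x) (P.bob_isChannel y)
    (Matrix.posSemidef_vecMulVec_self_star _)).submatrix _

theorem trace_midState (x y : Bits n) : (P.midState x y).trace = 1 := by
  let ε : Fin 2 × (P.M × P.M') ≃
      Fin 2 × ((Fin P.dM₀ × Fin P.dM₀') × (Fin P.dM₁ × Fin P.dM₁')) :=
    ⟨fun i => (i.1, ((i.2.1.1, i.2.2.1), (i.2.1.2, i.2.2.2))),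
      fun i => (i.1, ((i.2.1.1, i.2.2.1), (i.2.1.2, i.2.2.2))), fun _ => rfl, fun _ => rfl⟩
  have h : P.midState x y = (P.rawState x y).submatrix ε ε := rfl
  rw [h, trace_submatrix_equiv, rawState,
    trace_tensorMap_id_tensorMap (P.alice_isChannel x) (P.bob_isChannel y),
    trace_pureState_inputVec]

end Protocol

/-! ### Fidelity with a pure state -/

section Fidelity

variable {a : Type} [Fintype a] [DecidableEq a]

theorem posSemidef_pureState (v : a → ℂ) : (pureState v).PosSemidef :=
  Matrix.posSemidef_vecMulVec_self_star v

theorem pureState_mul_mul_pureState (v : a → ℂ) (ρ : Op a) :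
    pureState v * ρ * pureState v = (pureState v * ρ).trace • pureState v := by
  rw [pureState, Matrix.vecMulVec_mul, Matrix.vecMulVec_mul_vecMulVec, Matrix.trace_vecMulVec,
    dotProduct_comm, Matrix.vecMulVec_smul]

theorem pureState_mul_self {v : a → ℂ} (hv : (pureState v).trace = 1) :
    pureState v * pureState v = pureState v := by
  have h := pureState_mul_mul_pureState v 1
  rwa [mul_one, hv, one_smul] at h

theorem sqrt_eq_of_mul_self {A B : Op a} (hB : B.PosSemidef) (h : B * B = A) : CFC.sqrt A = B :=
  CFC.sqrt_unique h hB.nonneg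

/-- A rank-one projector is its own square root, and compressing `ρ` by it gives a multiple of the
projector; the trace of the root is the square root of `⟨v|ρ|v⟩`. -/
theorem fidelity_pureState {v : a → ℂ} (hv : (pureState v).trace = 1) {ρ : Op a}
    (hρ : ρ.PosSemidef) : fidelity ρ (pureState v) = √(pureState v * ρ).trace.re := by
  have hV := posSemidef_pureState v
  have hVV := pureState_mul_self hv
  have hc := trace_mul_nonneg hV hρ
  rw [Complex.nonneg_iff] at hc
  have hcr : (pureState v * ρ).trace = ((pureState v * ρ).trace.re : ℂ) :=
    Complex.ext (by simp) (by simp [← hc.2])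
  have hs : CFC.sqrt (pureState v * ρ * pureState v) =
      ((√(pureState v * ρ).trace.re : ℝ) : ℂ) • pureState v := by
    refine sqrt_eq_of_mul_self (hV.smul (by simp)) ?_
    rw [pureState_mul_mul_pureState, smul_mul_smul_comm, hVV, ← Complex.ofReal_mul,
      Real.mul_self_sqrt hc.1, ← hcr]
  rw [fidelity, sqrt_eq_of_mul_self hV hVV, hs, Matrix.trace_smul, hv]
  simp

theorem pureState_bell_apply (p q : Fin 2 × Fin 2) :
    pureState bell p q = if p.1 = p.2 ∧ q.1 = q.2 then (1 / 2 : ℂ) else 0 :=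
  bell_mul_star_bell p q

theorem trace_pureState_bell : (pureState bell).trace = 1 := by
  simp [Matrix.trace, pureState_bell_apply, Fintype.sum_prod_type]

end Fidelity

/-! ### Decoupling -/

section Decoupling

variable {m m' : Type} [Fintype m] [Fintype m'] [DecidableEq m] [DecidableEq m']

/-- The reduced state on `R ⊗ M`. -/
def marginal (ρ : Op (Fin 2 × (m × m'))) : Op (Fin 2 × m) :=
  Matrix.of fun i j => ∑ k, ρ (i.1, (i.2, k)) (j.1, (j.2, k))

/-- The state with the factors `M` and `M'` exchanged. -/
def swapState (ρ : Op (Fin 2 × (m × m'))) : Op (Fin 2 × (m' × m)) :=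
  ρ.submatrix ((Equiv.refl _).prodCongr (Equiv.prodComm _ _))
    ((Equiv.refl _).prodCongr (Equiv.prodComm _ _))

theorem trace_swapState (ρ : Op (Fin 2 × (m × m'))) : (swapState ρ).trace = ρ.trace :=
  trace_submatrix_equiv _ _

theorem posSemidef_swapState {ρ : Op (Fin 2 × (m × m'))} (hρ : ρ.PosSemidef) :
    (swapState ρ).PosSemidef :=
  hρ.submatrix _

theorem posSemidef_marginal {ρ : Op (Fin 2 × (m × m'))} (hρ : ρ.PosSemidef) :
    (marginal ρ).PosSemidef :=
  posSemidef_traceRight (hρ.submatrix (fun i : (Fin 2 × m) × m' => (i.1.1, (i.1.2, i.2))))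

theorem trace_marginal (ρ : Op (Fin 2 × (m × m'))) : (marginal ρ).trace = ρ.trace := by
  simp [Matrix.trace, marginal, Fintype.sum_prod_type]

/-- If the reference is recovered perfectly from `M`, then it is decoupled from `M'`. -/
theorem marginal_swapState_eq_of_fidelity {ρ : Op (Fin 2 × (m × m'))} (hρ : ρ.PosSemidef)
    (htr : ρ.trace = 1) {D : Op m →ₗ[ℂ] Op (Fin 2)} (hD : IsChannel D)
    (hF : 1 ≤ fidelity (tensorMap LinearMap.id D (marginal ρ)) (pureState bell)) :
    marginal (swapState ρ) =
      ((1 / 2 : ℂ) • (1 : Op (Fin 2))) ⊗ₖ traceLeft (marginal (swapState ρ)) := by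
  -- The decoder acts on `M` while `M'` is kept as a spectator; `σ'` is the result with the
  -- recovered qubit placed next to the reference.
  let ω : Op ((Fin 2 × m') × m) := ρ.submatrix (fun i => (i.1.1, (i.2, i.1.2)))
    (fun i => (i.1.1, (i.2, i.1.2)))
  let σ : Op ((Fin 2 × m') × Fin 2) := tensorMap LinearMap.id D ω
  let σ' : Op ((Fin 2 × Fin 2) × m') := σ.submatrix (fun i => ((i.1.1, i.2), i.1.2))
    (fun i => ((i.1.1, i.2), i.1.2))
  have hσ' : σ'.PosSemidef := (hD.posSemidef (hρ.submatrix _)).submatrix _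
  have hσ'tr : traceRight σ' = tensorMap LinearMap.id D (marginal ρ) := by
    ext p q
    simp only [traceRight, Matrix.of_apply, σ', σ, Matrix.submatrix_apply,
      tensorMap_id_left_apply]
    rw [← Matrix.sum_apply, ← map_sum]
    refine congrArg (fun Y => D Y p.2 q.2) ?_
    ext i j
    simp [ω, marginal, Matrix.sum_apply]
  have hpos : (tensorMap LinearMap.id D (marginal ρ)).PosSemidef :=
    hD.posSemidef (posSemidef_marginal hρ)
  have hσtr : σ'.trace = 1 := by
    rw [← trace_traceRight, hσ'tr, hD.trace_tensorMap, trace_marginal, htr]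
  have hVV := pureState_mul_self trace_pureState_bell
  have hVH := (posSemidef_pureState bell).isHermitian
  have hW : (1 - pureState bell).PosSemidef := by
    have h := Matrix.posSemidef_conjTranspose_mul_self (1 - pureState bell)
    rwa [Matrix.conjTranspose_sub, hVH.eq, Matrix.conjTranspose_one, mul_sub, sub_mul, sub_mul,
      one_mul, mul_one, one_mul, hVV, sub_self, sub_zero] at h
  have hW1 : ((1 - pureState bell) ⊗ₖ (1 : Op m')).PosSemidef := hW.kronecker Matrix.PosSemidef.one
  -- Fidelity 1 means that the projector complementary to `Ψ⁺` has probability zero.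
  have htrace : (((1 - pureState bell) ⊗ₖ (1 : Op m')) * σ').trace = 0 := by
    have h0 := trace_mul_nonneg hW1 hσ'
    have h1 : (((1 - pureState bell) ⊗ₖ (1 : Op m')) * σ').trace =
        1 - (pureState bell * tensorMap LinearMap.id D (marginal ρ)).trace := by
      rw [trace_kronecker_one_mul, hσ'tr, sub_mul, one_mul, Matrix.trace_sub, ← hσ'tr,
        trace_traceRight, hσtr]
    rw [fidelity_pureState trace_pureState_bell hpos, Real.one_le_sqrt] at hF
    rw [Complex.nonneg_iff] at h0
    refine Complex.ext (le_antisymm ?_ h0.1) h0.2.symm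
    rw [h1]
    simpa using hF
  have hker := mul_eq_zero_of_trace_mul_eq_zero hW1 hσ' htrace
  have hl : (pureState bell ⊗ₖ (1 : Op m')) * σ' = σ' := by
    rw [sub_kronecker, Matrix.one_kronecker_one, sub_mul, one_mul, sub_eq_zero] at hker
    exact hker.symm
  have hr : σ' * (pureState bell ⊗ₖ (1 : Op m')) = σ' := by
    have := congrArg Matrix.conjTranspose hl
    rwa [Matrix.conjTranspose_mul, Matrix.conjTranspose_kronecker, hVH.eq,
      Matrix.conjTranspose_one, hσ'.isHermitian.eq] at this
  -- Since `Ψ⁺ ⊗ 1` fixes `σ'` from both sides, `σ'` is `Ψ⁺` tensored with `κ = ⟨Ψ⁺|σ'|Ψ⁺⟩`.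
  let κ : m' → m' → ℂ := fun k l => ∑ r, ∑ q, ∑ s, ∑ t,
    star (bell (s, t)) * σ' ((s, t), k) ((r, q), l) * bell (r, q)
  have hentry : ∀ p q k l, σ' (p, k) (q, l) = bell p * star (bell q) * κ k l := by
    intro p q k l
    conv_lhs => rw [← hr, ← hl]
    simp only [Matrix.mul_apply, Fintype.sum_prod_type, Matrix.kroneckerMap_apply,
      Matrix.one_apply, mul_ite, mul_one, mul_zero, ite_mul, zero_mul, Finset.sum_ite_eq,
      Finset.sum_ite_eq', Finset.mem_univ, if_true, pureState, Matrix.vecMulVec_apply,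
      Pi.star_apply]
    simp only [κ, Finset.sum_mul, Finset.mul_sum]
    refine Finset.sum_congr rfl fun _ _ => Finset.sum_congr rfl fun _ _ =>
      Finset.sum_congr rfl fun _ _ => Finset.sum_congr rfl fun _ _ => ?_
    ring
  have hmarg : ∀ r s k l, marginal (swapState ρ) (r, k) (s, l) =
      if r = s then (1 / 2 : ℂ) * κ k l else 0 := by
    intro r s k l
    have h1 : marginal (swapState ρ) (r, k) (s, l) = traceRight ω (r, k) (s, l) := rfl
    -- The decoder preserves the trace, so tracing out `M` agrees with tracing out the recovered
    -- qubit, which leaves `I/2 ⊗ κ`.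
    rw [h1, ← hD.traceRight_tensorMap]
    have h2 : ∀ q, σ ((r, k), q) ((s, l), q) =
        (if r = q ∧ s = q then (1 / 2 : ℂ) else 0) * κ k l := fun q => by
      rw [← bell_mul_star_bell (r, q) (s, q)]
      exact hentry (r, q) (s, q) k l
    change ∑ q, σ ((r, k), q) ((s, l), q) = _
    rw [Finset.sum_congr rfl fun q _ => h2 q]
    fin_cases r <;> fin_cases s <;> simp
  ext ⟨r, k⟩ ⟨s, l⟩
  rw [Matrix.kroneckerMap_apply]
  simp only [traceLeft, Matrix.of_apply, hmarg]
  by_cases h : r = s <;> simp [h]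

/-- If the reference is decoupled from `M`, then it is recovered from `M` with fidelity `1 / 2`. -/
theorem fidelity_of_decoupled {X : Op (Fin 2 × m)} (hX : X.PosSemidef) (htr : X.trace = 1)
    (hdec : X = ((1 / 2 : ℂ) • (1 : Op (Fin 2))) ⊗ₖ traceLeft X) {D : Op m →ₗ[ℂ] Op (Fin 2)}
    (hD : IsChannel D) : fidelity (tensorMap LinearMap.id D X) (pureState bell) = 1 / 2 := by
  rw [fidelity_pureState trace_pureState_bell (hD.posSemidef hX)]
  have hτ : (D (traceLeft X)).trace = 1 := by
    rw [hD.trace_preserving, trace_traceLeft, htr]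
  -- The overlap of `Ψ⁺` with `I/2 ⊗ τ` is `tr τ / 4`.
  have h : (pureState bell * tensorMap LinearMap.id D X).trace = ((1 / 4 : ℝ) : ℂ) := by
    have hDX : tensorMap LinearMap.id D X =
        ((1 / 2 : ℂ) • (1 : Op (Fin 2))) ⊗ₖ D (traceLeft X) := by
      conv_lhs => rw [hdec, tensorMap_kronecker]
      rfl
    rw [hDX]
    simp only [Matrix.trace, Matrix.diag, Fin.sum_univ_two] at hτ
    simp only [Matrix.trace, Matrix.diag, Matrix.mul_apply, Fintype.sum_prod_type,
      pureState_bell_apply, Fin.sum_univ_two, Matrix.kroneckerMap_apply,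
      Matrix.smul_apply, Matrix.one_apply]
    simp
    linear_combination (1 / 4 : ℂ) * hτ
  rw [h, Complex.ofReal_re, show (1 / 4 : ℝ) = (1 / 2) ^ 2 by norm_num,
    Real.sqrt_sq (by norm_num)]

/-- The structure function is the squared Hilbert-Schmidt norm of a Hermitian operator, so it
detects decoupling exactly. -/
theorem eq_of_trace_sub_sq_eq_zero {X : Op (Fin 2 × m)} (hX : X.PosSemidef)
    (h : ((X - ((1 / 2 : ℂ) • (1 : Op (Fin 2))) ⊗ₖ traceLeft X) ^ 2).trace = 0) :
    X = ((1 / 2 : ℂ) • (1 : Op (Fin 2))) ⊗ₖ traceLeft X := by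
  refine sub_eq_zero.mp (eq_zero_of_trace_sq_eq_zero (hX.isHermitian.sub ?_) h)
  have h2 : (((1 / 2 : ℂ) • (1 : Op (Fin 2))) ⊗ₖ traceLeft X).PosSemidef :=
    (Matrix.PosSemidef.one.smul (by norm_num [Complex.nonneg_iff])).kronecker (posSemidef_traceLeft hX)
  exact h2.isHermitian

end Decoupling

/-! ### Zero and nonzero entries of the routing structure functions -/

namespace Protocol

variable {n : ℕ} {P : Protocol n} {f : Bits n → Bits n → Bool} {ε : ℝ} {x y : Bits n}

theorem stateRM_eq : P.stateRM x y = marginal (P.midState x y) := rfl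

theorem stateRM'_eq : P.stateRM' x y = marginal (swapState (P.midState x y)) := rfl

theorem posSemidef_stateRM : (P.stateRM x y).PosSemidef :=
  posSemidef_marginal (P.posSemidef_midState x y)

theorem posSemidef_stateRM' : (P.stateRM' x y).PosSemidef :=
  stateRM'_eq ▸ posSemidef_marginal (posSemidef_swapState (P.posSemidef_midState x y))

theorem trace_stateRM : (P.stateRM x y).trace = 1 := by
  rw [stateRM_eq, trace_marginal, trace_midState]

theorem trace_stateRM' : (P.stateRM' x y).trace = 1 := by
  rw [stateRM'_eq, trace_marginal, trace_swapState, trace_midState]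

theorem RoutingCorrect.structure_eq_zero (h : P.RoutingCorrect f 0 ε) (hf : f x y = false) :
    P.routingStructure x y = 0 := by
  obtain ⟨D, hD, hF⟩ := (h x y).1 hf
  rw [sub_zero] at hF
  have := marginal_swapState_eq_of_fidelity (P.posSemidef_midState x y) (P.trace_midState x y) hD hF
  rw [routingStructure, Matrix.of_apply, stateRM'_eq, sub_eq_zero.mpr this]
  simp

theorem RoutingCorrect.structure_ne_zero (h : P.RoutingCorrect f ε 0.05) (hf : f x y = true) :
    P.routingStructure x y ≠ 0 := by
  intro h0
  obtain ⟨D, hD, hF⟩ := (h x y).2 hf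
  rw [fidelity_of_decoupled posSemidef_stateRM' trace_stateRM'
    (eq_of_trace_sub_sq_eq_zero posSemidef_stateRM' h0) hD] at hF
  norm_num at hF

theorem RoutingCorrect.structureRev_eq_zero (h : P.RoutingCorrect f ε 0) (hf : f x y = true) :
    P.routingStructureRev x y = 0 := by
  obtain ⟨D, hD, hF⟩ := (h x y).2 hf
  rw [sub_zero] at hF
  have := marginal_swapState_eq_of_fidelity (posSemidef_swapState (P.posSemidef_midState x y))
    ((trace_swapState _).trans (P.trace_midState x y)) hD hF
  have h2 : swapState (swapState (P.midState x y)) = P.midState x y := rfl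
  rw [h2] at this
  rw [routingStructureRev, Matrix.of_apply, stateRM_eq, sub_eq_zero.mpr this]
  simp

theorem RoutingCorrect.structureRev_ne_zero (h : P.RoutingCorrect f 0.05 ε) (hf : f x y = false) :
    P.routingStructureRev x y ≠ 0 := by
  intro h0
  obtain ⟨D, hD, hF⟩ := (h x y).1 hf
  rw [fidelity_of_decoupled posSemidef_stateRM trace_stateRM
    (eq_of_trace_sub_sq_eq_zero posSemidef_stateRM h0) hD] at hF
  norm_num at hF

end Protocol

/-! ### Perfectly correct BB84 measurements -/

section BB84

variable {m m' : Type} [Fintype m] [Fintype m'] [DecidableEq m] [DecidableEq m']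

theorem trace_single_kronecker_mul (r : Fin 2) (A : Op m) (ρ : Op (Fin 2 × (m × m'))) :
    ((Matrix.single r r (1 : ℂ) ⊗ₖ (A ⊗ₖ (1 : Op m'))) * ρ).trace =
      (A * condState (marginal ρ) r).trace := by
  simp only [Matrix.trace, Matrix.diag, Matrix.mul_apply, Fintype.sum_prod_type, marginal, condState,
    Matrix.kroneckerMap_apply, Matrix.of_apply, Matrix.one_apply, mul_ite, mul_one, mul_zero,
    ite_mul, zero_mul, Finset.sum_ite_eq, Finset.mem_univ, if_true, Finset.mul_sum,
    Matrix.single_apply]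
  rw [Finset.sum_eq_single r (fun s _ hs => by simp [Ne.symm hs]) (by simp)]
  refine Finset.sum_congr rfl fun i _ => ?_
  rw [Finset.sum_comm]
  rw [Finset.sum_eq_single r (fun s _ hs => by simp [Ne.symm hs]) (by simp), Finset.sum_comm]
  simp

theorem condState_mul_eq_zero {r : Fin 2} {A : Op m} {ρ : Op (Fin 2 × (m × m'))}
    (h : (Matrix.single r r (1 : ℂ) ⊗ₖ (A ⊗ₖ (1 : Op m'))) * ρ = 0) (hA : A.PosSemidef)
    (hρ : (condState (marginal ρ) r).PosSemidef) : A * condState (marginal ρ) r = 0 :=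
  mul_eq_zero_of_trace_mul_eq_zero hA hρ (by rw [← trace_single_kronecker_mul, h, Matrix.trace_zero])

theorem posSemidef_condState {ρ : Op (Fin 2 × (m × m'))} (hρ : ρ.PosSemidef) (r : Fin 2) :
    (condState (marginal ρ) r).PosSemidef :=
  (posSemidef_marginal hρ).submatrix (fun k => (r, k))

theorem posSemidef_single (r : Fin 2) : (Matrix.single r r (1 : ℂ)).PosSemidef := by
  have h := Matrix.posSemidef_conjTranspose_mul_self (Matrix.single r r (1 : ℂ))
  simpa using h

theorem swapState_kronecker_mul (A : Op (Fin 2)) (B : Op m) (C : Op m')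
    (ρ : Op (Fin 2 × (m × m'))) :
    (A ⊗ₖ (C ⊗ₖ B)) * swapState ρ = swapState ((A ⊗ₖ (B ⊗ₖ C)) * ρ) := by
  rw [swapState, swapState, ← Matrix.submatrix_mul_equiv (A ⊗ₖ (B ⊗ₖ C)) ρ _
    ((Equiv.refl (Fin 2)).prodCongr (Equiv.prodComm m' m))]
  congr 1
  ext p q
  simp [mul_comm]

/-- Outcomes that do not all agree annihilate the state of a perfectly correct protocol. -/
theorem kronecker_mul_eq_zero_of_correct {ρ : Op (Fin 2 × (m × m'))} (hρ : ρ.PosSemidef)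
    (htr : ρ.trace = 1) {Q : Fin 2 → Op (Fin 2)} {Λ : Fin 2 → Op m} {Λ' : Fin 2 → Op m'}
    (hQ : ∀ b, (Q b).PosSemidef) (hQ1 : ∑ b, Q b = 1) (hΛ : ∀ b, (Λ b).PosSemidef)
    (hΛ1 : ∑ b, Λ b = 1) (hΛ' : ∀ b, (Λ' b).PosSemidef) (hΛ'1 : ∑ b, Λ' b = 1)
    (h : 1 ≤ (∑ b, ((Q b ⊗ₖ (Λ b ⊗ₖ Λ' b)) * ρ).trace).re) {b c : Fin 2} (hbc : b ≠ c) :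
    (Q b ⊗ₖ (Λ c ⊗ₖ (1 : Op m'))) * ρ = 0 := by
  -- `t b c d` is the joint probability of the outcomes on `R`, `M` and `M'`.
  let t : Fin 2 → Fin 2 → Fin 2 → ℂ := fun b c d => ((Q b ⊗ₖ (Λ c ⊗ₖ Λ' d)) * ρ).trace
  have hpsd : ∀ b c d, (Q b ⊗ₖ (Λ c ⊗ₖ Λ' d)).PosSemidef := fun b c d =>
    (hQ b).kronecker ((hΛ c).kronecker (hΛ' d))
  have ht : ∀ b c d, 0 ≤ (t b c d).re ∧ 0 = (t b c d).im := fun b c d =>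
    Complex.nonneg_iff.mp (trace_mul_nonneg (hpsd b c d) hρ)
  have hsum : ∑ b, ∑ c, ∑ d, t b c d = 1 := by
    rw [← htr, ← one_mul ρ, ← Matrix.one_kronecker_one, ← Matrix.one_kronecker_one, ← hQ1, ← hΛ1,
      ← hΛ'1]
    simp only [t, Fin.sum_univ_two, Matrix.add_kronecker, Matrix.kronecker_add, add_mul,
      Matrix.trace_add]
    ring
  -- Eight nonnegative numbers sum to 1 and the two with all outcomes equal already reach 1, so the
  -- other six vanish.
  have hzero : ∀ d, t b c d = 0 := by
    intro d
    have hs := congrArg Complex.re hsum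
    have h' : 1 ≤ (∑ b, t b b b).re := h
    simp only [Fin.sum_univ_two, Complex.add_re, Complex.one_re] at hs h'
    have h001 := (ht 0 0 1).1
    have h010 := (ht 0 1 0).1
    have h011 := (ht 0 1 1).1
    have h100 := (ht 1 0 0).1
    have h101 := (ht 1 0 1).1
    have h110 := (ht 1 1 0).1
    refine Complex.ext (le_antisymm ?_ (ht b c d).1) (ht b c d).2.symm
    fin_cases b <;> fin_cases c <;> fin_cases d <;> simp at hbc ⊢ <;> linarith
  rw [← hΛ'1]
  simp only [Fin.sum_univ_two, Matrix.kronecker_add, add_mul]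
  rw [mul_eq_zero_of_trace_mul_eq_zero (hpsd b c 0) hρ (hzero 0),
    mul_eq_zero_of_trace_mul_eq_zero (hpsd b c 1) hρ (hzero 1), add_zero]

/-- If `M` determines the computational-basis outcome, then `ρ⁰_M` and `ρ¹_M` are orthogonal. -/
theorem condState_mul_condState_eq_zero {ρ : Op (Fin 2 × (m × m'))} (hρ : ρ.PosSemidef)
    {Λ : Fin 2 → Op m} (hΛ : ∀ b, (Λ b).PosSemidef) (hΛ1 : ∑ b, Λ b = 1)
    (h : ∀ b c, b ≠ c → (Matrix.single b b (1 : ℂ) ⊗ₖ (Λ c ⊗ₖ (1 : Op m'))) * ρ = 0) :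
    condState (marginal ρ) 0 * condState (marginal ρ) 1 = 0 := by
  have h0 := posSemidef_condState hρ 0
  have h1 := posSemidef_condState hρ 1
  have h10 := condState_mul_eq_zero (h 0 1 (by decide)) (hΛ 1) h0
  have h01 := condState_mul_eq_zero (h 1 0 (by decide)) (hΛ 0) h1
  have h10' : condState (marginal ρ) 0 * Λ 1 = 0 := by
    have := congrArg Matrix.conjTranspose h10
    rwa [Matrix.conjTranspose_mul, (hΛ 1).isHermitian.eq, h0.isHermitian.eq,
      Matrix.conjTranspose_zero] at this
  rw [Fin.sum_univ_two] at hΛ1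
  calc _ = condState (marginal ρ) 0 * (Λ 0 + Λ 1) * condState (marginal ρ) 1 := by
        rw [hΛ1, mul_one]
    _ = 0 := by rw [mul_add, h10', add_zero, mul_assoc, h01, mul_zero]

/-- If `M'` determines the outcome of a measurement complementary to the computational basis, then
`M` does not determine the computational-basis outcome. -/
theorem trace_condState_mul_condState_ne_zero {ρ : Op (Fin 2 × (m × m'))} (hρ : ρ.PosSemidef)
    (htr : ρ.trace = 1) {Q : Fin 2 → Op (Fin 2)} {Λ' : Fin 2 → Op m'} (hQ1 : ∑ b, Q b = 1)
    (hQ : !![1, 0; 0, -1] * (Q 0 - Q 1) = -((Q 0 - Q 1) * !![1, 0; 0, -1]))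
    (hΛ'1 : ∑ b, Λ' b = 1)
    (h : ∀ b c, b ≠ c → (Q b ⊗ₖ ((1 : Op m) ⊗ₖ Λ' c)) * ρ = 0) :
    (condState (marginal ρ) 0 * condState (marginal ρ) 1).trace ≠ 0 := by
  intro hg
  set ρ₀ := condState (marginal ρ) 0 with hρ₀
  set ρ₁ := condState (marginal ρ) 1 with hρ₁
  have h0 : ρ₀.PosSemidef := posSemidef_condState hρ 0
  have h1 : ρ₁.PosSemidef := posSemidef_condState hρ 1
  -- If `ρ₀` and `ρ₁` are orthogonal, they can themselves serve as unnormalised measurement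
  -- operators on `M` that never disagree with the reference.
  have hk0 : (Matrix.single 0 0 (1 : ℂ) ⊗ₖ (ρ₁ ⊗ₖ (1 : Op m'))) * ρ = 0 := by
    refine mul_eq_zero_of_trace_mul_eq_zero
      ((posSemidef_single 0).kronecker (h1.kronecker Matrix.PosSemidef.one)) hρ ?_
    rw [trace_single_kronecker_mul, Matrix.trace_mul_comm]
    exact hg
  have hk1 : (Matrix.single 1 1 (1 : ℂ) ⊗ₖ (ρ₀ ⊗ₖ (1 : Op m'))) * ρ = 0 := by
    refine mul_eq_zero_of_trace_mul_eq_zero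
      ((posSemidef_single 1).kronecker (h0.kronecker Matrix.PosSemidef.one)) hρ ?_
    rw [trace_single_kronecker_mul]
    exact hg
  have hZ : (!![1, 0; 0, -1] : Op (Fin 2)) = Matrix.single 0 0 1 - Matrix.single 1 1 1 := by
    ext i j
    fin_cases i <;> fin_cases j <;> simp
  have hI : (1 : Op (Fin 2)) = Matrix.single 0 0 1 + Matrix.single 1 1 1 := by
    ext i j
    fin_cases i <;> fin_cases j <;> simp
  -- With the cross terms gone, `Z ⊗ (ρ₀ - ρ₁)` acts on `ρ` as the reduced state `ρ₀ + ρ₁` of `M`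
  -- does.
  have hZρ : ((!![1, 0; 0, -1] : Op (Fin 2)) ⊗ₖ ((ρ₀ - ρ₁) ⊗ₖ (1 : Op m'))) * ρ =
      ((1 : Op (Fin 2)) ⊗ₖ ((ρ₀ + ρ₁) ⊗ₖ (1 : Op m'))) * ρ := by
    rw [hZ, hI]
    simp only [sub_kronecker, kronecker_sub, Matrix.add_kronecker, Matrix.kronecker_add, sub_mul,
      add_mul, hk0, hk1]
    abel
  -- Perfect agreement between `Q` and `Λ'` makes the product of the two observables fix `ρ`.
  have hXρ : ((Q 0 - Q 1) ⊗ₖ ((1 : Op m) ⊗ₖ (Λ' 0 - Λ' 1))) * ρ = ρ := by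
    have h1ρ : ((Q 0 + Q 1) ⊗ₖ ((1 : Op m) ⊗ₖ (Λ' 0 + Λ' 1))) * ρ = ρ := by
      rw [← Fin.sum_univ_two Q, ← Fin.sum_univ_two Λ', hQ1, hΛ'1, Matrix.one_kronecker_one,
        Matrix.one_kronecker_one, one_mul]
    conv_rhs => rw [← h1ρ]
    simp only [sub_kronecker, kronecker_sub, Matrix.add_kronecker, Matrix.kronecker_add, sub_mul,
      add_mul, h 0 1 zero_ne_one, h 1 0 one_ne_zero]
    abel
  -- The operators in `hZρ` and `hXρ` anticommute, because they do so on `R` and act on different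
  -- systems otherwise. Hence `(ρ₀ + ρ₁) ρ` equals its own negative.
  have hTρ : ((1 : Op (Fin 2)) ⊗ₖ ((ρ₀ + ρ₁) ⊗ₖ (1 : Op m'))) * ρ = 0 := by
    have e1 : ((!![1, 0; 0, -1] : Op (Fin 2)) ⊗ₖ ((ρ₀ - ρ₁) ⊗ₖ (1 : Op m'))) *
        (((Q 0 - Q 1) ⊗ₖ ((1 : Op m) ⊗ₖ (Λ' 0 - Λ' 1))) * ρ) =
        -(((Q 0 - Q 1) ⊗ₖ ((1 : Op m) ⊗ₖ (Λ' 0 - Λ' 1))) *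
        (((!![1, 0; 0, -1] : Op (Fin 2)) ⊗ₖ ((ρ₀ - ρ₁) ⊗ₖ (1 : Op m'))) * ρ)) := by
      rw [← mul_assoc, ← mul_assoc, ← neg_mul]
      congr 1
      rw [← Matrix.mul_kronecker_mul, ← Matrix.mul_kronecker_mul, ← Matrix.mul_kronecker_mul,
        ← Matrix.mul_kronecker_mul, hQ, mul_one, one_mul, mul_one, one_mul]
      ext p q
      simp
    have e2 : ((Q 0 - Q 1) ⊗ₖ ((1 : Op m) ⊗ₖ (Λ' 0 - Λ' 1))) *
        (((1 : Op (Fin 2)) ⊗ₖ ((ρ₀ + ρ₁) ⊗ₖ (1 : Op m'))) * ρ) =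
        ((1 : Op (Fin 2)) ⊗ₖ ((ρ₀ + ρ₁) ⊗ₖ (1 : Op m'))) *
        (((Q 0 - Q 1) ⊗ₖ ((1 : Op m) ⊗ₖ (Λ' 0 - Λ' 1))) * ρ) := by
      rw [← mul_assoc, ← mul_assoc]
      congr 1
      rw [← Matrix.mul_kronecker_mul, ← Matrix.mul_kronecker_mul, ← Matrix.mul_kronecker_mul,
        ← Matrix.mul_kronecker_mul]
      simp only [mul_one, one_mul]
    rw [hXρ, hZρ, e2, hXρ] at e1
    ext i j
    exact self_eq_neg.mp (congrFun (congrFun e1 i) j)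
  -- As `ρ₀ + ρ₁` is the reduced state of `M`, the trace of `hTρ` is the trace of its square.
  have hT : ρ₀ + ρ₁ = 0 := by
    refine eq_zero_of_trace_sq_eq_zero (h0.add h1).isHermitian ?_
    have := congrArg Matrix.trace hTρ
    rw [hI, Matrix.add_kronecker, add_mul, Matrix.trace_add, trace_single_kronecker_mul,
      trace_single_kronecker_mul, ← hρ₀, ← hρ₁, ← Matrix.trace_add, ← mul_add,
      Matrix.trace_zero] at this
    rw [sq, this]
  have htr' : (ρ₀ + ρ₁).trace = 1 := by
    rw [← htr, ← trace_marginal, Matrix.trace_add]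
    simp [Matrix.trace, hρ₀, hρ₁, condState, Fintype.sum_prod_type]
  rw [hT, Matrix.trace_zero] at htr'
  exact zero_ne_one htr'

theorem hadamard_mul_self : hadamard * hadamard = 1 := by
  have h := inv_sqrt_two_mul_self
  rw [hadamard, smul_mul_smul_comm, h]
  ext i j
  fin_cases i <;> fin_cases j <;> simp <;> norm_num

theorem hadamard_isHermitian : hadamard.IsHermitian := by
  ext i j
  fin_cases i <;> fin_cases j <;> simp [hadamard]

theorem posSemidef_bb84Proj (q : ℕ) (b : Fin 2) : (bb84Proj q b).PosSemidef := by
  have h := (posSemidef_single b).mul_mul_conjTranspose_same (hadamard ^ q)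
  rwa [(hadamard_isHermitian.pow q).eq] at h

theorem sum_bb84Proj (q : ℕ) : ∑ b, bb84Proj q b = 1 := by
  have hI : Matrix.single 0 0 1 + Matrix.single 1 1 1 = (1 : Op (Fin 2)) := by
    ext i j
    fin_cases i <;> fin_cases j <;> simp
  rw [Fin.sum_univ_two]
  simp only [bb84Proj]
  rw [← add_mul, ← mul_add, hI, mul_one, ← (Commute.refl _).mul_pow, hadamard_mul_self,
    one_pow]

theorem bb84Proj_zero (b : Fin 2) : bb84Proj 0 b = Matrix.single b b 1 := by
  simp [bb84Proj]

/-- The difference of the Hadamard-basis projectors is the Pauli matrix `X`, which anticommutes with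
`Z`. -/
theorem bb84Proj_one_anticommute :
    !![1, 0; 0, -1] * (bb84Proj 1 0 - bb84Proj 1 1) =
      -((bb84Proj 1 0 - bb84Proj 1 1) * !![1, 0; 0, -1]) := by
  have h := inv_sqrt_two_mul_self
  have hX : bb84Proj 1 0 - bb84Proj 1 1 = !![0, 1; 1, 0] := by
    simp only [bb84Proj, pow_one, hadamard, Matrix.smul_mul, Matrix.mul_smul, smul_smul, h]
    ext i j
    fin_cases i <;> fin_cases j <;>
      simp [Matrix.mul_apply, Matrix.single_apply, Fin.sum_univ_two, Matrix.vecMul, dotProduct] <;>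
      norm_num
  rw [hX]
  ext i j
  fin_cases i <;> fin_cases j <;> simp

end BB84

/-! ### Zero and nonzero entries of the BB84 structure function -/

namespace Protocol

variable {n : ℕ} {P : Protocol n} {f : Bits n → Bits n → Bool} {x y : Bits n}

theorem BB84Correct.kronecker_mul_eq_zero (h : P.BB84Correct f 0) (x y : Bits n) :
    ∃ (Λ : Fin 2 → Op P.M) (Λ' : Fin 2 → Op P.M'),
      (∀ b, (Λ b).PosSemidef) ∧ ∑ b, Λ b = 1 ∧ (∀ b, (Λ' b).PosSemidef) ∧ ∑ b, Λ' b = 1 ∧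
      (∀ b c, b ≠ c →
        (bb84Proj (f x y).toNat b ⊗ₖ (Λ c ⊗ₖ (1 : Op P.M'))) * P.midState x y = 0) ∧
      ∀ b c, b ≠ c →
        (bb84Proj (f x y).toNat b ⊗ₖ (Λ' c ⊗ₖ (1 : Op P.M))) * swapState (P.midState x y) = 0 := by
  obtain ⟨Λ, Λ', hΛ, hΛ1, hΛ', hΛ'1, hc⟩ := h x y
  rw [sub_zero] at hc
  refine ⟨Λ, Λ', hΛ, hΛ1, hΛ', hΛ'1, fun b c hbc => ?_, fun b c hbc => ?_⟩
  · exact kronecker_mul_eq_zero_of_correct (P.posSemidef_midState x y) (P.trace_midState x y)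
      (posSemidef_bb84Proj _) (sum_bb84Proj _) hΛ hΛ1 hΛ' hΛ'1 hc hbc
  · refine kronecker_mul_eq_zero_of_correct (posSemidef_swapState (P.posSemidef_midState x y))
      ((trace_swapState _).trans (P.trace_midState x y))
      (posSemidef_bb84Proj _) (sum_bb84Proj _) hΛ' hΛ'1 hΛ hΛ1 ?_ hbc
    simpa only [swapState_kronecker_mul, trace_swapState] using hc

theorem BB84Correct.structure_eq_zero (h : P.BB84Correct f 0) (hf : f x y = false) :
    P.bb84Structure x y = 0 := by
  obtain ⟨Λ, Λ', hΛ, hΛ1, hΛ', hΛ'1, hz, hz'⟩ := h.kronecker_mul_eq_zero x y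
  simp only [hf, Bool.toNat_false, bb84Proj_zero] at hz hz'
  rw [bb84Structure, Matrix.of_apply, stateRM_eq, stateRM'_eq,
    condState_mul_condState_eq_zero (P.posSemidef_midState x y) hΛ hΛ1 hz,
    condState_mul_condState_eq_zero (posSemidef_swapState (P.posSemidef_midState x y)) hΛ' hΛ'1 hz']
  simp

/-- Both summands are nonnegative, so it is enough that the one for `M` is nonzero; this follows
from Bob's knowledge of the Hadamard-basis outcome. -/
theorem BB84Correct.structure_ne_zero (h : P.BB84Correct f 0) (hf : f x y = true) :
    P.bb84Structure x y ≠ 0 := by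
  obtain ⟨Λ, Λ', hΛ, hΛ1, hΛ', hΛ'1, hz, hz'⟩ := h.kronecker_mul_eq_zero x y
  simp only [hf, Bool.toNat_true] at hz hz'
  have hρ := P.posSemidef_midState x y
  have hρs := posSemidef_swapState hρ
  have h1 : 0 ≤ (condState (marginal (P.midState x y)) 0 *
      condState (marginal (P.midState x y)) 1).trace :=
    trace_mul_nonneg (posSemidef_condState hρ 0) (posSemidef_condState hρ 1)
  have h2 : 0 ≤ (condState (marginal (swapState (P.midState x y))) 0 *
      condState (marginal (swapState (P.midState x y))) 1).trace :=
    trace_mul_nonneg (posSemidef_condState hρs 0) (posSemidef_condState hρs 1)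
  have h3 := trace_condState_mul_condState_ne_zero hρ (P.trace_midState x y) (sum_bb84Proj 1)
    bb84Proj_one_anticommute hΛ'1 fun b c hbc => by
      have := congrArg swapState (hz' b c hbc)
      rwa [← swapState_kronecker_mul] at this
  intro h0
  rw [bb84Structure, Matrix.of_apply, stateRM_eq, stateRM'_eq] at h0
  exact h3 ((add_eq_zero_iff_of_nonneg h1 h2).mp h0).1

end Protocol

/-! ### The rank of structure functions -/

/-- The columns of `A` are expanded in a basis of the column space. This plays the role of the
Schmidt decomposition; orthogonality is not needed. -/
theorem exists_rank_factorization {l e : Type} [Fintype l] [Fintype e] [DecidableEq e]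
    (A : Matrix l e ℂ) : ∃ (U : Matrix l (Fin A.rank) ℂ) (V : Matrix (Fin A.rank) e ℂ), A = U * V := by
  let b := Module.finBasis ℂ (LinearMap.range A.mulVecLin)
  let col : e → LinearMap.range A.mulVecLin := fun j => ⟨A.mulVecLin (Pi.single j 1), ⟨_, rfl⟩⟩
  refine ⟨Matrix.of fun i s => (b s : l → ℂ) i, Matrix.of fun s j => b.repr (col j) s, ?_⟩
  ext i j
  have h : ((∑ s, b.repr (col j) s • b s : LinearMap.range A.mulVecLin) : l → ℂ) i = A i j := by
    rw [b.sum_repr]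
    simp [col]
  rw [← h]
  simp only [Submodule.coe_sum, Submodule.coe_smul, Finset.sum_apply, Pi.smul_apply, smul_eq_mul,
    Matrix.mul_apply, Matrix.of_apply]
  exact Finset.sum_congr rfl fun s _ => mul_comm _ _

section Rank

variable {a b c d e m ι X Y : Type} [Fintype a] [Fintype b] [Fintype c] [Fintype d] [Fintype e]
  [Fintype m] [Fintype ι] [Fintype X] [Fintype Y] [DecidableEq a] [DecidableEq b] [DecidableEq c]
  [DecidableEq d] [DecidableEq e] [DecidableEq m]

/-- The operator `A ⊗ B` on `R ⊗ (M₀ ⊗ M₁)`. -/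
def assocKronecker (A : Op (e × a)) (B : Op c) : Op (e × (a × c)) :=
  (A ⊗ₖ B).submatrix (Equiv.prodAssoc e a c).symm (Equiv.prodAssoc e a c).symm

theorem assocKronecker_apply (A : Op (e × a)) (B : Op c) (i j : e × (a × c)) :
    assocKronecker A B i j = A (i.1, i.2.1) (j.1, j.2.1) * B i.2.2 j.2.2 := rfl

theorem tensorMap_assocKronecker (Φ : Op a →ₗ[ℂ] Op b) (Ψ : Op c →ₗ[ℂ] Op d) (A : Op (e × a))
    (B : Op c) : tensorMap LinearMap.id (tensorMap Φ Ψ) (assocKronecker A B) =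
      assocKronecker (tensorMap LinearMap.id Φ A) (Ψ B) := by
  ext p q
  rw [tensorMap_id_left_apply, assocKronecker_apply, tensorMap_id_left_apply]
  have h : (assocKronecker A B).submatrix (fun k => (p.1, k)) (fun k => (q.1, k)) =
      (A.submatrix (fun k => (p.1, k)) (fun k => (q.1, k))) ⊗ₖ B := rfl
  rw [h, tensorMap_kronecker]
  rfl

/-- A matrix of traces of products of sums of `ι` product operators has rank at most `|ι|²`. -/
theorem rank_trace_mul_le (A A' : ι → X → Op a) (B B' : ι → Y → Op c) :
    (Matrix.of fun x y => ((∑ i, A i x ⊗ₖ B i y) * ∑ i, A' i x ⊗ₖ B' i y).trace).rank ≤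
      Fintype.card ι ^ 2 := by
  -- Each pair of summands contributes a function of `x` times a function of `y`, so the matrix
  -- factors through `ι × ι`.
  have h : (Matrix.of fun x y => ((∑ i, A i x ⊗ₖ B i y) * ∑ i, A' i x ⊗ₖ B' i y).trace) =
      (Matrix.of fun x (p : ι × ι) => (A p.1 x * A' p.2 x).trace) *
        (Matrix.of fun (p : ι × ι) y => (B p.1 y * B' p.2 y).trace) := by
    ext x y
    simp only [Matrix.of_apply, Matrix.mul_apply, Finset.sum_mul, Finset.mul_sum, Matrix.trace_sum,
      ← Matrix.mul_kronecker_mul, Matrix.trace_kronecker, Fintype.sum_prod_type]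
    exact Finset.sum_comm
  rw [h]
  refine (Matrix.rank_mul_le_left _ _).trans ((Matrix.rank_le_card_width _).trans ?_)
  rw [Fintype.card_prod, sq]

/-- The map `X ↦ X - I/2 ⊗ tr_R X` acts on the reference only, which sits in the factor `A`; the
split between `x` and `y` therefore survives. -/
theorem sub_traceLeft_assocKronecker (A : ι → Op (Fin 2 × a)) (B : ι → Op c) :
    (∑ i, assocKronecker (A i) (B i)) -
      ((1 / 2 : ℂ) • (1 : Op (Fin 2))) ⊗ₖ traceLeft (∑ i, assocKronecker (A i) (B i)) =
    ∑ i, assocKronecker (A i - ((1 / 2 : ℂ) • (1 : Op (Fin 2))) ⊗ₖ traceLeft (A i)) (B i) := by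
  ext p q
  simp only [Matrix.sub_apply, Matrix.sum_apply, assocKronecker_apply, Matrix.kroneckerMap_apply,
    traceLeft, Matrix.of_apply, Fin.sum_univ_two, ← Finset.sum_add_distrib, Finset.mul_sum,
    ← Finset.sum_sub_distrib]
  exact Finset.sum_congr rfl fun i _ => by ring

theorem matrix_rank_add_le (A B : Matrix X Y ℂ) : (A + B).rank ≤ A.rank + B.rank := by
  rw [Matrix.rank, Matrix.mulVecLin_add]
  exact (Submodule.finrank_mono (LinearMap.range_add_le _ _)).trans
    (Submodule.finrank_add_le_finrank_add_finrank _ _)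

theorem rank_trace_sub_sq_le {F : X → Y → Op (Fin 2 × (a × c))} {A : ι → X → Op (Fin 2 × a)}
    {B : ι → Y → Op c} (hF : ∀ x y, F x y = ∑ i, assocKronecker (A i x) (B i y)) :
    (Matrix.of fun x y => ((F x y - ((1 / 2 : ℂ) • (1 : Op (Fin 2))) ⊗ₖ
      traceLeft (F x y)) ^ 2).trace).rank ≤ Fintype.card ι ^ 2 := by
  let A' : ι → X → Op (Fin 2 × a) := fun i x =>
    A i x - ((1 / 2 : ℂ) • (1 : Op (Fin 2))) ⊗ₖ traceLeft (A i x)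
  refine le_trans (le_of_eq ?_) (rank_trace_mul_le A' A' B B)
  congr 1
  ext x y
  have h : ∑ i, assocKronecker (A' i x) (B i y) = (∑ i, A' i x ⊗ₖ B i y).submatrix
      (Equiv.prodAssoc (Fin 2) a c).symm (Equiv.prodAssoc (Fin 2) a c).symm := by
    ext p q
    simp [assocKronecker, Matrix.sum_apply]
  rw [Matrix.of_apply, Matrix.of_apply, hF, sub_traceLeft_assocKronecker, h, sq,
    Matrix.submatrix_mul_equiv, trace_submatrix_equiv]

theorem rank_trace_condState_le {F : X → Y → Op (Fin 2 × (a × c))} {A : ι → X → Op (Fin 2 × a)}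
    {B : ι → Y → Op c} (hF : ∀ x y, F x y = ∑ i, assocKronecker (A i x) (B i y)) :
    (Matrix.of fun x y => (condState (F x y) 0 * condState (F x y) 1).trace).rank ≤
      Fintype.card ι ^ 2 := by
  refine le_trans (le_of_eq ?_) (rank_trace_mul_le (fun i x => condState (A i x) 0)
    (fun i x => condState (A i x) 1) B B)
  congr 1
  ext x y
  have h : ∀ r, condState (F x y) r = ∑ i, condState (A i x) r ⊗ₖ B i y := by
    intro r
    rw [hF]
    ext p q
    simp [condState, Matrix.sum_apply, assocKronecker_apply]
  rw [Matrix.of_apply, Matrix.of_apply, h, h]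

end Rank

/-! ### Product expansions of the mid-protocol state and rank bounds -/

namespace Protocol

variable {n : ℕ} (P : Protocol n)

/-- Ket and bra of the resource each contribute one index of size `schmidtRank`. The pair `Ψ⁺` lies
wholly on Alice's side and adds no terms. -/
theorem exists_rawState_eq : ∃ (A : Fin P.schmidtRank × Fin P.schmidtRank → Bits n →
      Op (Fin 2 × (Fin P.dM₀ × Fin P.dM₀')))
    (B : Fin P.schmidtRank × Fin P.schmidtRank → Bits n → Op (Fin P.dM₁ × Fin P.dM₁')),
    ∀ x y, P.rawState x y = ∑ i, assocKronecker (A i x) (B i y) := by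
  obtain ⟨U, V, hUV⟩ := exists_rank_factorization (Matrix.of fun i j => P.ψ (i, j))
  have hψ : ∀ l e, P.ψ (l, e) = ∑ s, U l s * V s e := fun l e =>
    congrFun (congrFun hUV l) e
  let α : Fin P.schmidtRank × Fin P.schmidtRank → Op (Fin 2 × (Fin 2 × Fin P.dL)) := fun i =>
    Matrix.of fun p q => bell (p.1, p.2.1) * U p.2.2 i.1 * star (bell (q.1, q.2.1) * U q.2.2 i.2)
  let β : Fin P.schmidtRank × Fin P.schmidtRank → Op (Fin P.dE) := fun i =>
    Matrix.of fun p q => V i.1 p * star (V i.2 q)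
  have hX : pureState P.inputVec = ∑ i, assocKronecker (α i) (β i) := by
    ext p q
    simp only [pureState, Matrix.vecMulVec_apply, Pi.star_apply, inputVec, hψ, Matrix.sum_apply,
      assocKronecker_apply, α, β, Matrix.of_apply, Fintype.sum_prod_type, star_mul', star_sum,
      Finset.mul_sum, Finset.sum_mul]
    rw [Finset.sum_comm]
    exact Finset.sum_congr rfl fun s _ => Finset.sum_congr rfl fun t _ => by ring
  refine ⟨fun i x => tensorMap LinearMap.id (P.alice x) (α i), fun i y => P.bob y (β i),
    fun x y => ?_⟩
  rw [rawState, hX, map_sum]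
  exact Finset.sum_congr rfl fun i _ => tensorMap_assocKronecker _ _ _ _

theorem exists_stateRM_eq : ∃ (A : Fin P.schmidtRank × Fin P.schmidtRank → Bits n →
      Op (Fin 2 × Fin P.dM₀))
    (B : Fin P.schmidtRank × Fin P.schmidtRank → Bits n → Op (Fin P.dM₁)),
    ∀ x y, P.stateRM x y = ∑ i, assocKronecker (A i x) (B i y) := by
  obtain ⟨A, B, h⟩ := P.exists_rawState_eq
  refine ⟨fun i x => marginal (A i x), fun i y => traceRight (B i y), fun x y => ?_⟩
  ext p q
  simp only [stateRM, midState, h, Matrix.of_apply, Matrix.submatrix_apply, Matrix.sum_apply,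
    assocKronecker_apply, marginal, traceRight, Finset.sum_mul_sum]
  rw [Finset.sum_comm]
  exact Finset.sum_congr rfl fun i _ => Fintype.sum_prod_type _

theorem exists_stateRM'_eq : ∃ (A : Fin P.schmidtRank × Fin P.schmidtRank → Bits n →
      Op (Fin 2 × Fin P.dM₀'))
    (B : Fin P.schmidtRank × Fin P.schmidtRank → Bits n → Op (Fin P.dM₁')),
    ∀ x y, P.stateRM' x y = ∑ i, assocKronecker (A i x) (B i y) := by
  obtain ⟨A, B, h⟩ := P.exists_rawState_eq
  refine ⟨fun i x => marginal (swapState (A i x)), fun i y => traceLeft (B i y), fun x y => ?_⟩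
  ext p q
  simp only [stateRM', midState, h, Matrix.of_apply, Matrix.submatrix_apply, Matrix.sum_apply,
    assocKronecker_apply, marginal, traceLeft, Finset.sum_mul_sum]
  rw [Finset.sum_comm]
  exact Finset.sum_congr rfl fun i _ => Fintype.sum_prod_type _

theorem card_schmidt_sq :
    Fintype.card (Fin P.schmidtRank × Fin P.schmidtRank) ^ 2 = P.schmidtRank ^ 4 := by
  rw [Fintype.card_prod, Fintype.card_fin]
  ring

theorem rank_routingStructure_le : P.routingStructure.rank ≤ P.schmidtRank ^ 4 := by
  obtain ⟨A, B, h⟩ := P.exists_stateRM'_eq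
  exact (rank_trace_sub_sq_le h).trans P.card_schmidt_sq.le

theorem rank_routingStructureRev_le : P.routingStructureRev.rank ≤ P.schmidtRank ^ 4 := by
  obtain ⟨A, B, h⟩ := P.exists_stateRM_eq
  exact (rank_trace_sub_sq_le h).trans P.card_schmidt_sq.le

theorem rank_bb84Structure_le : P.bb84Structure.rank ≤ 2 * P.schmidtRank ^ 4 := by
  obtain ⟨A, B, h⟩ := P.exists_stateRM_eq
  obtain ⟨A', B', h'⟩ := P.exists_stateRM'_eq
  have h1 := (rank_trace_condState_le h).trans P.card_schmidt_sq.le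
  have h2 := (rank_trace_condState_le h').trans P.card_schmidt_sq.le
  rw [two_mul]
  exact (matrix_rank_add_le _ _).trans (add_le_add h1 h2)

/-- A product resource state gives a structure function of product form. -/
theorem routingStructureRev_eq_zero_of_product (hr : P.schmidtRank = 1) {x y : Bits n}
    (h : P.routingStructureRev x y = 0) (z : Bits n) : P.routingStructureRev x z = 0 := by
  obtain ⟨A, B, hAB⟩ := P.exists_stateRM_eq
  have hs : Subsingleton (Fin P.schmidtRank) := by rw [hr]; infer_instance
  let o : Fin P.schmidtRank := ⟨0, by omega⟩
  have : Unique (Fin P.schmidtRank × Fin P.schmidtRank) :=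
    ⟨⟨(o, o)⟩, fun i => Subsingleton.elim _ _⟩
  have h0 := sub_eq_zero.mpr (eq_of_trace_sub_sq_eq_zero posSemidef_stateRM h)
  rw [hAB, sub_traceLeft_assocKronecker, Fintype.sum_unique] at h0
  -- The single Bob factor cannot vanish because the state has trace 1; hence the zero at `(x, y)`
  -- comes from Alice's factor, which does not depend on `y`.
  have hB : B default y ≠ 0 := by
    intro hB
    have ht := P.trace_stateRM (x := x) (y := y)
    rw [hAB, Fintype.sum_unique, hB] at ht
    simp [assocKronecker] at ht
  have hA : A default x - ((1 / 2 : ℂ) • (1 : Op (Fin 2))) ⊗ₖ traceLeft (A default x) = 0 := by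
    by_contra hA
    obtain ⟨k, l, hkl⟩ : ∃ k l, B default y k l ≠ 0 := by
      by_contra! hne
      exact hB (by ext k l; exact hne k l)
    refine hA ?_
    ext p q
    have := congrFun (congrFun h0 (p.1, (p.2, k))) (q.1, (q.2, l))
    rw [assocKronecker_apply] at this
    exact (mul_eq_zero.mp this).resolve_right hkl
  rw [routingStructureRev, Matrix.of_apply, hAB, sub_traceLeft_assocKronecker, Fintype.sum_unique, hA]
  simp [assocKronecker]

end Protocol

/-! ### Lower bounds on the Schmidt rank -/

theorem div_four_le_logb {n r : ℕ} (h : 2 ^ n ≤ r ^ 4) : (n / 4 : ℝ) ≤ Real.logb 2 r := by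
  have h' : (2 : ℝ) ^ n ≤ (r : ℝ) ^ 4 := by exact_mod_cast h
  have hlog := Real.logb_le_logb_of_le (b := 2) (by norm_num) (by positivity) h'
  rw [Real.logb_pow, Real.logb_pow, Real.logb_self_eq_one (by norm_num)] at hlog
  push_cast at hlog
  linarith

theorem sub_one_div_four_le_logb {n r : ℕ} (h : 2 ^ n ≤ 2 * r ^ 4) :
    ((n - 1) / 4 : ℝ) ≤ Real.logb 2 r := by
  have hr : r ≠ 0 := by
    rintro rfl
    simp at h
  have h' : (2 : ℝ) ^ n ≤ 2 * (r : ℝ) ^ 4 := by exact_mod_cast h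
  have hlog := Real.logb_le_logb_of_le (b := 2) (by norm_num) (by positivity) h'
  rw [Real.logb_mul (by norm_num) (by positivity), Real.logb_pow, Real.logb_pow,
    Real.logb_self_eq_one (by norm_num)] at hlog
  push_cast at hlog
  linarith

/-- Otherwise `r ^ 4 + 1 = 2 ^ n`. Even `r` fails by parity; for odd `r` the left side is 2 modulo
4, forcing `n = 1` and `r = 1`. -/
theorem two_pow_le_pow_four {n r : ℕ} (h : 2 ^ n - 1 ≤ r ^ 4) (hn : n ≠ 0) (hr : r ≠ 1) :
    2 ^ n ≤ r ^ 4 := by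
  by_contra! hlt
  have heq : r ^ 4 + 1 = 2 ^ n := by omega
  obtain ⟨k, rfl⟩ := Nat.exists_eq_succ_of_ne_zero hn
  rcases Nat.even_or_odd' r with ⟨t, rfl | rfl⟩
  · have : (2 * t) ^ 4 = 2 * (8 * t ^ 4) := by ring
    rw [pow_succ] at heq
    omega
  · have : (2 * t + 1) ^ 4 = 4 * (4 * t ^ 4 + 8 * t ^ 3 + 6 * t ^ 2 + 2 * t) + 1 := by ring
    rcases k with _ | k
    · have h0 : (2 * t + 1) ^ 4 = 1 := by
        norm_num at heq
        exact Nat.pow_eq_one.mpr (Or.inl (by omega))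
      exact hr (Nat.pow_eq_one.mp h0 |>.resolve_right (by norm_num))
    · rw [Nat.succ_eq_add_one, pow_succ, pow_succ] at heq
      omega

theorem le_routingCost {n : ℕ} {f : Bits n → Bits n → Bool} {ε₀ ε₁ c : ℝ}
    (h : ∀ P : Protocol n, P.RoutingCorrect f ε₀ ε₁ → c ≤ Real.logb 2 P.schmidtRank) :
    (c : EReal) ≤ routingCost f ε₀ ε₁ :=
  le_iInf₂ fun P hP => EReal.coe_le_coe_iff.mpr (h P hP)

theorem le_pFBB84 {n : ℕ} {f : Bits n → Bits n → Bool} {c : ℝ}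
    (h : ∀ P : Protocol n, P.BB84Correct f 0 → c ≤ Real.logb 2 P.schmidtRank) :
    (c : EReal) ≤ pFBB84 f :=
  le_iInf₂ fun P hP => EReal.coe_le_coe_iff.mpr (h P hP)

/-! ### Structure functions with prescribed zeros -/

section Structure

variable {n : ℕ} {G : Matrix (Bits n) (Bits n) ℂ}

theorem diagonalPattern_of_eqFn (h0 : ∀ x y, eqFn n x y = false → G x y = 0)
    (h1 : ∀ x y, eqFn n x y = true → G x y ≠ 0) : DiagonalPattern G :=
  ⟨fun x y hxy => h0 x y (by simpa [eqFn] using hxy), fun x => h1 x x (by simp [eqFn])⟩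

theorem diagonalPattern_of_neqFn (h0 : ∀ x y, neqFn n x y = true → G x y = 0)
    (h1 : ∀ x y, neqFn n x y = false → G x y ≠ 0) : DiagonalPattern G :=
  ⟨fun x y hxy => h0 x y (by simpa [neqFn] using hxy), fun x => h1 x x (by simp [neqFn])⟩

theorem triangularPattern_of_gtFn (h0 : ∀ x y, gtFn n x y = false → G x y = 0)
    (h1 : ∀ x y, gtFn n x y = true → G x y ≠ 0) : TriangularPattern G :=
  ⟨fun x y hxy => h0 x y (by simpa [gtFn] using hxy), fun x => h1 x x (by simp [gtFn])⟩

theorem triangularPattern_of_ltFn (h0 : ∀ x y, ltFn n x y = false → G x y = 0)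
    (h1 : ∀ x y, ltFn n x y = true → G x y ≠ 0) : TriangularPattern Gᵀ :=
  ⟨fun x y hxy => h0 y x (by simpa [ltFn] using hxy), fun x => h1 x x (by simp [ltFn])⟩

theorem strictTriangularPattern_of_gtFn (h0 : ∀ x y, gtFn n x y = true → G x y = 0)
    (h1 : ∀ x y, gtFn n x y = false → G x y ≠ 0) : StrictTriangularPattern G :=
  ⟨fun x y hxy => h0 x y (by simpa [gtFn] using hxy),
    fun x y hxy => h1 x y (by simp [gtFn, hxy])⟩

theorem strictTriangularPattern_of_ltFn (h0 : ∀ x y, ltFn n x y = true → G x y = 0)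
    (h1 : ∀ x y, ltFn n x y = false → G x y ≠ 0) : StrictTriangularPattern Gᵀ :=
  ⟨fun x y hxy => h0 y x (by simpa [ltFn] using hxy),
    fun x y hxy => h1 y x (by simp [ltFn, hxy])⟩

theorem antitriangularPattern_of_disjFn (h0 : ∀ x y, disjFn n x y = false → G x y = 0)
    (h1 : ∀ x y, disjFn n x y = true → G x y ≠ 0) : AntitriangularPattern G :=
  .of_disjoint (fun x y h => h0 x y (by simpa [disjFn] using h))
    fun x y h => h1 x y (by simpa [disjFn] using h)

theorem antitriangularPattern_of_intFn (h0 : ∀ x y, intFn n x y = true → G x y = 0)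
    (h1 : ∀ x y, intFn n x y = false → G x y ≠ 0) : AntitriangularPattern G :=
  .of_disjoint (fun x y h => h0 x y (by simpa [intFn] using h))
    fun x y h => h1 x y (by simpa [intFn] using h)

end Structure

namespace Protocol

variable {n : ℕ} {P : Protocol n}

theorem div_four_le_of_rank_routingStructure (P : Protocol n) (h : P.routingStructure.rank = 2 ^ n) :
    (n / 4 : ℝ) ≤ Real.logb 2 P.schmidtRank :=
  div_four_le_logb (h ▸ P.rank_routingStructure_le)

theorem div_four_le_of_rank_routingStructureRev (P : Protocol n) (h : P.routingStructureRev.rank = 2 ^ n) :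
    (n / 4 : ℝ) ≤ Real.logb 2 P.schmidtRank :=
  div_four_le_logb (h ▸ P.rank_routingStructureRev_le)

theorem sub_one_div_four_le_of_rank_bb84Structure (P : Protocol n) (h : P.bb84Structure.rank = 2 ^ n) :
    ((n - 1) / 4 : ℝ) ≤ Real.logb 2 P.schmidtRank :=
  sub_one_div_four_le_logb (h ▸ P.rank_bb84Structure_le)

/-- A resource state is not a product state if some row of the structure function has both a zero
and a nonzero entry; then rank `2 ^ n - 1` suffices for the lower bound `n / 4`. -/
theorem div_four_le_of_rank_eq_sub_one (h : P.routingStructureRev.rank = 2 ^ n - 1)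
    (hrow : n ≠ 0 → ∃ x y z, P.routingStructureRev x y = 0 ∧ P.routingStructureRev x z ≠ 0) :
    (n / 4 : ℝ) ≤ Real.logb 2 P.schmidtRank := by
  rcases eq_or_ne n 0 with rfl | hn
  · rw [Nat.cast_zero, zero_div]
    -- For `n = 0` only nonnegativity of the logarithm is needed, and the convention `Real.log 0 =
    -- 0` makes it hold for every natural number.
    exact div_nonneg (Real.log_natCast_nonneg _) (Real.log_nonneg (by norm_num))
  · obtain ⟨x, y, z, hxy, hxz⟩ := hrow hn
    exact div_four_le_logb (two_pow_le_pow_four (h ▸ P.rank_routingStructureRev_le) hn fun hr =>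
      hxz (P.routingStructureRev_eq_zero_of_product hr hxy z))

theorem exists_bitVal_eq_zero_and_one (hn : n ≠ 0) :
    ∃ x y : Bits n, bitVal x = 0 ∧ bitVal y = 1 := by
  obtain ⟨e, he⟩ := exists_bitVal_eq n
  have h1 : 1 < 2 ^ n := Nat.one_lt_two_pow hn
  exact ⟨e ⟨0, by omega⟩, e ⟨1, h1⟩, he _, he _⟩

theorem div_four_le_of_strictTriangularPattern (P : Protocol n)
    (h : StrictTriangularPattern P.routingStructureRev) :
    (n / 4 : ℝ) ≤ Real.logb 2 P.schmidtRank := by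
  refine div_four_le_of_rank_eq_sub_one h.rank fun hn => ?_
  obtain ⟨x, y, hx, hy⟩ := exists_bitVal_eq_zero_and_one hn
  -- Row 0 has a zero in column 0 and a nonzero entry in column 1.
  exact ⟨x, x, y, h.1 x x le_rfl, h.2 x y (by omega)⟩

theorem div_four_le_of_strictTriangularPattern_transpose (P : Protocol n)
    (h : StrictTriangularPattern P.routingStructureRevᵀ) :
    (n / 4 : ℝ) ≤ Real.logb 2 P.schmidtRank := by
  refine div_four_le_of_rank_eq_sub_one h.rank_transpose fun hn => ?_
  obtain ⟨x, y, hx, hy⟩ := exists_bitVal_eq_zero_and_one hn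
  have h0 := h.1 y y le_rfl
  have h1 := h.2 x y (by omega)
  rw [Matrix.transpose_apply] at h0 h1
  -- After transposition it is row 1 that has a zero, in column 1, and a nonzero entry, in column 0.
  exact ⟨y, y, x, h0, h1⟩

theorem RoutingCorrect.diagonalPattern_eqFn (h : P.RoutingCorrect (eqFn n) 0 0.05) :
    DiagonalPattern P.routingStructure :=
  diagonalPattern_of_eqFn (fun _ _ => h.structure_eq_zero) fun _ _ => h.structure_ne_zero

theorem RoutingCorrect.diagonalPattern_neqFn (h : P.RoutingCorrect (neqFn n) 0.05 0) :
    DiagonalPattern P.routingStructureRev :=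
  diagonalPattern_of_neqFn (fun _ _ => h.structureRev_eq_zero) fun _ _ => h.structureRev_ne_zero

theorem RoutingCorrect.triangularPattern_gtFn (h : P.RoutingCorrect (gtFn n) 0 0.05) :
    TriangularPattern P.routingStructure :=
  triangularPattern_of_gtFn (fun _ _ => h.structure_eq_zero) fun _ _ => h.structure_ne_zero

theorem RoutingCorrect.strictTriangularPattern_gtFn (h : P.RoutingCorrect (gtFn n) 0.05 0) :
    StrictTriangularPattern P.routingStructureRev :=
  strictTriangularPattern_of_gtFn (fun _ _ => h.structureRev_eq_zero)
    fun _ _ => h.structureRev_ne_zero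

theorem RoutingCorrect.triangularPattern_ltFn (h : P.RoutingCorrect (ltFn n) 0 0.05) :
    TriangularPattern P.routingStructureᵀ :=
  triangularPattern_of_ltFn (fun _ _ => h.structure_eq_zero) fun _ _ => h.structure_ne_zero

theorem RoutingCorrect.strictTriangularPattern_ltFn (h : P.RoutingCorrect (ltFn n) 0.05 0) :
    StrictTriangularPattern P.routingStructureRevᵀ :=
  strictTriangularPattern_of_ltFn (fun _ _ => h.structureRev_eq_zero)
    fun _ _ => h.structureRev_ne_zero

theorem RoutingCorrect.antitriangularPattern_disjFn (h : P.RoutingCorrect (disjFn n) 0 0.05) :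
    AntitriangularPattern P.routingStructure :=
  antitriangularPattern_of_disjFn (fun _ _ => h.structure_eq_zero) fun _ _ => h.structure_ne_zero

theorem RoutingCorrect.antitriangularPattern_intFn (h : P.RoutingCorrect (intFn n) 0.05 0) :
    AntitriangularPattern P.routingStructureRev :=
  antitriangularPattern_of_intFn (fun _ _ => h.structureRev_eq_zero)
    fun _ _ => h.structureRev_ne_zero

theorem BB84Correct.diagonalPattern_eqFn (h : P.BB84Correct (eqFn n) 0) :
    DiagonalPattern P.bb84Structure :=
  diagonalPattern_of_eqFn (fun _ _ => h.structure_eq_zero) fun _ _ => h.structure_ne_zero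

theorem BB84Correct.triangularPattern_gtFn (h : P.BB84Correct (gtFn n) 0) :
    TriangularPattern P.bb84Structure :=
  triangularPattern_of_gtFn (fun _ _ => h.structure_eq_zero) fun _ _ => h.structure_ne_zero

theorem BB84Correct.triangularPattern_ltFn (h : P.BB84Correct (ltFn n) 0) :
    TriangularPattern P.bb84Structureᵀ :=
  triangularPattern_of_ltFn (fun _ _ => h.structure_eq_zero) fun _ _ => h.structure_ne_zero

theorem BB84Correct.antitriangularPattern_disjFn (h : P.BB84Correct (disjFn n) 0) :
    AntitriangularPattern P.bb84Structure :=
  antitriangularPattern_of_disjFn (fun _ _ => h.structure_eq_zero) fun _ _ => h.structure_ne_zero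

end Protocol

end NLQC

theorem mainTheorem3 (n : ℕ) :
    -- zero patterns and ranks of the structure functions for `f`-routing
    (∀ P : Protocol n,
      (P.RoutingCorrect (eqFn n) 0 0.05 →
        DiagonalPattern P.routingStructure ∧ P.routingStructure.rank = 2 ^ n) ∧
      (P.RoutingCorrect (neqFn n) 0.05 0 →
        DiagonalPattern P.routingStructureRev ∧ P.routingStructureRev.rank = 2 ^ n) ∧
      (P.RoutingCorrect (gtFn n) 0 0.05 →
        TriangularPattern P.routingStructure ∧ P.routingStructure.rank = 2 ^ n) ∧
      (P.RoutingCorrect (gtFn n) 0.05 0 →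
        StrictTriangularPattern P.routingStructureRev ∧
          P.routingStructureRev.rank = 2 ^ n - 1) ∧
      (P.RoutingCorrect (ltFn n) 0 0.05 →
        TriangularPattern P.routingStructureᵀ ∧ P.routingStructure.rank = 2 ^ n) ∧
      (P.RoutingCorrect (ltFn n) 0.05 0 →
        StrictTriangularPattern P.routingStructureRevᵀ ∧
          P.routingStructureRev.rank = 2 ^ n - 1) ∧
      (P.RoutingCorrect (disjFn n) 0 0.05 →
        AntitriangularPattern P.routingStructure ∧ P.routingStructure.rank = 2 ^ n) ∧
      (P.RoutingCorrect (intFn n) 0.05 0 →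
        AntitriangularPattern P.routingStructureRev ∧ P.routingStructureRev.rank = 2 ^ n)) ∧
    -- zero patterns and ranks of the structure functions for `f`-BB84
    (∀ P : Protocol n,
      (P.BB84Correct (eqFn n) 0 →
        DiagonalPattern P.bb84Structure ∧ P.bb84Structure.rank = 2 ^ n) ∧
      (P.BB84Correct (gtFn n) 0 →
        TriangularPattern P.bb84Structure ∧ P.bb84Structure.rank = 2 ^ n) ∧
      (P.BB84Correct (ltFn n) 0 →
        TriangularPattern P.bb84Structureᵀ ∧ P.bb84Structure.rank = 2 ^ n) ∧
      (P.BB84Correct (disjFn n) 0 →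
        AntitriangularPattern P.bb84Structure ∧ P.bb84Structure.rank = 2 ^ n)) ∧
    -- lower bounds on the entanglement cost of `f`-routing
    (((n / 4 : ℝ) : EReal) ≤ FR₀ (eqFn n) ∧
      ((n / 4 : ℝ) : EReal) ≤ FR₁ (neqFn n) ∧
      ((n / 4 : ℝ) : EReal) ≤ FR₀ (gtFn n) ∧
      ((n / 4 : ℝ) : EReal) ≤ FR₁ (gtFn n) ∧
      ((n / 4 : ℝ) : EReal) ≤ FR₀ (ltFn n) ∧
      ((n / 4 : ℝ) : EReal) ≤ FR₁ (ltFn n) ∧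
      ((n / 4 : ℝ) : EReal) ≤ FR₀ (disjFn n) ∧
      ((n / 4 : ℝ) : EReal) ≤ FR₁ (intFn n)) ∧
    -- lower bounds on the entanglement cost of perfectly correct `f`-BB84
    ((((n - 1) / 4 : ℝ) : EReal) ≤ pFBB84 (eqFn n) ∧
      (((n - 1) / 4 : ℝ) : EReal) ≤ pFBB84 (gtFn n) ∧
      (((n - 1) / 4 : ℝ) : EReal) ≤ pFBB84 (ltFn n) ∧
      (((n - 1) / 4 : ℝ) : EReal) ≤ pFBB84 (disjFn n)) := by
  refine ⟨fun P => ⟨fun h => ?_, fun h => ?_, fun h => ?_, fun h => ?_, fun h => ?_, fun h => ?_,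
    fun h => ?_, fun h => ?_⟩, fun P => ⟨fun h => ?_, fun h => ?_, fun h => ?_, fun h => ?_⟩,
    ⟨?_, ?_, ?_, ?_, ?_, ?_, ?_, ?_⟩, ?_, ?_, ?_, ?_⟩
  · exact ⟨h.diagonalPattern_eqFn, h.diagonalPattern_eqFn.rank⟩
  · exact ⟨h.diagonalPattern_neqFn, h.diagonalPattern_neqFn.rank⟩
  · exact ⟨h.triangularPattern_gtFn, h.triangularPattern_gtFn.rank⟩
  · exact ⟨h.strictTriangularPattern_gtFn, h.strictTriangularPattern_gtFn.rank⟩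
  · exact ⟨h.triangularPattern_ltFn, h.triangularPattern_ltFn.rank_transpose⟩
  · exact ⟨h.strictTriangularPattern_ltFn, h.strictTriangularPattern_ltFn.rank_transpose⟩
  · exact ⟨h.antitriangularPattern_disjFn, h.antitriangularPattern_disjFn.rank⟩
  · exact ⟨h.antitriangularPattern_intFn, h.antitriangularPattern_intFn.rank⟩
  · exact ⟨h.diagonalPattern_eqFn, h.diagonalPattern_eqFn.rank⟩
  · exact ⟨h.triangularPattern_gtFn, h.triangularPattern_gtFn.rank⟩
  · exact ⟨h.triangularPattern_ltFn, h.triangularPattern_ltFn.rank_transpose⟩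
  · exact ⟨h.antitriangularPattern_disjFn, h.antitriangularPattern_disjFn.rank⟩
  · exact le_routingCost fun P h =>
      P.div_four_le_of_rank_routingStructure h.diagonalPattern_eqFn.rank
  · exact le_routingCost fun P h =>
      P.div_four_le_of_rank_routingStructureRev h.diagonalPattern_neqFn.rank
  · exact le_routingCost fun P h =>
      P.div_four_le_of_rank_routingStructure h.triangularPattern_gtFn.rank
  · exact le_routingCost fun P h => P.div_four_le_of_strictTriangularPattern
      h.strictTriangularPattern_gtFn
  · exact le_routingCost fun P h =>
      P.div_four_le_of_rank_routingStructure h.triangularPattern_ltFn.rank_transpose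
  · exact le_routingCost fun P h => P.div_four_le_of_strictTriangularPattern_transpose
      h.strictTriangularPattern_ltFn
  · exact le_routingCost fun P h =>
      P.div_four_le_of_rank_routingStructure h.antitriangularPattern_disjFn.rank
  · exact le_routingCost fun P h =>
      P.div_four_le_of_rank_routingStructureRev h.antitriangularPattern_intFn.rank
  · exact le_pFBB84 fun P h =>
      P.sub_one_div_four_le_of_rank_bb84Structure h.diagonalPattern_eqFn.rank
  · exact le_pFBB84 fun P h =>
      P.sub_one_div_four_le_of_rank_bb84Structure h.triangularPattern_gtFn.rank
  · exact le_pFBB84 fun P h =>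
      P.sub_one_div_four_le_of_rank_bb84Structure h.triangularPattern_ltFn.rank_transpose
  · exact le_pFBB84 fun P h =>
      P.sub_one_div_four_le_of_rank_bb84Structure h.antitriangularPattern_disjFn.rank
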